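/- **Setting.** Let $\mathcal X$ be a measurable space of arms and, for $x\in\mathcal X$, let $M_x$ be a probability distribution on $[0,1]$ with mean $f(x)=\int y\,dM_x(y)$; assume that $f$ is measurable and put $f^*=\sup_{x\in\mathcal X}f(x)$ and $\mathcal X_\epsilon=\{x: f(x)\ge f^*-\epsilon\}$. Let $\nu_1>0$, $\rho\in(0,1)$, and let $(\mathcal P_{h,i})_{h\ge 0,\,1\le i\le 2^h}$ be measurable subsets of $\mathcal X$ with $\mathcal P_{0,1}=\mathcal X$ and $\mathcal P_{h,i}=\mathcal P_{h+1,2i-1}\cup\mathcal P_{h+1,2i}$. Node $(h,i)$ of the infinite binary tree has the children $(h+1,2i-1)$ and $(h+1,2i)$; $\mathcal C(h,i)$ is the set of its descendants, itself included. **Assumptions.** Let $\ell:\mathcal X^2\to[0,\infty)$ with $\ell(x,x)=0$ for all $x$; put $\mathcal B(x,r)=\{y:\ell(x,y)<r\}$ and $\operatorname{diam}(A)=\sup_{x,y\in A}\ell(x,y)$, and let $\mathcal N(A,\ell,\epsilon)$ be the largest number of pairwise disjoint balls $\mathcal B(x,\epsilon)$ contained in $A$. Suppose that, for some constants $\nu_2,L,\epsilon_0,C>0$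 and $d\ge 0$: * (A1) for all $h\ge 0$: $\operatorname{diam}(\mathcal P_{h,i})\le\nu_1\rho^h$ for all $i$, and there are points $x^\circ_{h,i}\in\mathcal P_{h,i}$ such that $\mathcal B(x^\circ_{h,i},\nu_2\rho^h)\subset\mathcal P_{h,i}$ and these balls are pairwise disjoint for $1\le i\le 2^h$; * (A2') for every nonempty $A\subset\mathcal X$ with $\sup_A f=f^*$ and $\operatorname{diam}(A)\le\epsilon_0$ one has $f^*-\inf_A f\le\operatorname{diam}(A)$; and for all $x\in\mathcal X_{\epsilon_0}$ and $\epsilon\in[0,\epsilon_0]$, $\mathcal B\bigl(x,f^*-f(x)+\epsilon\bigr)\subset\mathcal X_{L(2(f^*-f(x))+\epsilon)}$; * (A3) for all $0<\epsilon\le\epsilon_0$, $\mathcal N(\mathcal X_{c\epsilon},\ell,\epsilon)\le C\epsilon^{-d}$, where $c=4L\nu_1/\nu_2$. **Algorithm $z$-HOO.** Let $(H_t,I_t)$, $X_t$, $Y_t$ be the node selected, the arm played and the reward received in round $t$. After $n$ rounds let $\mathcal T_n=\{(0,1)\}\cup\{(H_t,I_t):t\le n\}$, let $T_{h,i}(n)=\#\{t\le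 n:(H_t,I_t)\in\mathcal C(h,i)\}$, let $\widehat\mu_{h,i}(n)$ be the average of the rewards $Y_t$ over these rounds $t$, and let $$U_{h,i}(n)=\widehat\mu_{h,i}(n)+\sqrt{\frac{2\ln n}{T_{h,i}(n)}}+\nu_1\rho^h\ \text{ if } T_{h,i}(n)>0,\qquad U_{h,i}(n)=+\infty\ \text{ otherwise},$$ $$B_{h,i}(n)=\min\bigl\{U_{h,i}(n),\max\{B_{h+1,2i-1}(n),B_{h+1,2i}(n)\}\bigr\}\ \text{ if } (h,i)\in\mathcal T_n,\qquad B_{h,i}(n)=+\infty\ \text{ otherwise}.$$ In round $n+1$ the algorithm starts at a node of depth $z$ with the largest value $B_{z,i}(n)$, moves to a child with the largest $B$-value as long as the current node belongs to $\mathcal T_n$, and selects the first node $(H_{n+1},I_{n+1})\notin\mathcal T_n$ so reached; it then plays an arm $X_{n+1}\in\mathcal P_{H_{n+1},I_{n+1}}$ and receives $Y_{n+1}$, whose conditional law, given the nodes, arms and rewards of the first $n$ rounds and given $(H_{n+1},I_{n+1})$ and $X_{n+1}$, is $M_{X_{n+1}}$. Ties and the choice of the arm in the region are resolved in an arbitrary,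 possibly randomized and history-dependent, way. The regret is $R_n=nf^*-\sum_{t=1}^n f(X_t)$. **Theorem (regret bound for $z$-HOO).** Let $h_0$ be the smallest integer $h\ge 0$ such that $2\nu_1\rho^{h}<\epsilon_0$, let $z\ge h_0$ be an integer, and put $$\gamma=\frac{4CL\nu_1\nu_2^{-d}}{(1/\rho)^{d+1}-1}\left(\frac{16}{\nu_1^2\rho^2}+9\right).$$ If $n\ge 2$ is large enough so that $$z\le\frac1{d+2}\,\frac{\ln(4L\nu_1n)-\ln(\gamma\ln n)}{\ln(1/\rho)},$$ then $z$-HOO satisfies $$\mathbb E[R_n]\le\left(1+\frac1{\rho^{d+2}}\right)(4L\nu_1n)^{(d+1)/(d+2)}(\gamma\ln n)^{1/(d+2)}+(2^z-1)\left(\frac{8\ln n}{\nu_1^2\rho^{2z}}+4\right).$$ -/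

import Mathlib

open MeasureTheory

noncomputable section

namespace HOO

/-! ### Dissimilarities, balls, diameters, packing numbers -/

section Dissimilarity

variable {X : Type*}

/-- A dissimilarity: a nonnegative function on pairs that vanishes on the diagonal. -/
structure IsDissimilarity (l : X → X → ℝ) : Prop where
  nonneg : ∀ x y, 0 ≤ l x y
  self : ∀ x, l x x = 0

/-- The open ball `{y | l x y < r}`. -/
def ball (l : X → X → ℝ) (x : X) (r : ℝ) : Set X := {y | l x y < r}

/-- The diameter `sup_{x, y ∈ A} l x y`, as an extended nonnegative number
(equal to `∞` when `l` is unbounded on `A`). -/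
def diam (l : X → X → ℝ) (A : Set X) : ENNReal :=
  ⨆ x ∈ A, ⨆ y ∈ A, ENNReal.ofReal (l x y)

/-- The packing number of `A` at scale `r`: the largest number (possibly infinite) of pairwise
disjoint open balls of radius `r` that are contained in `A`. -/
def packingNumber (l : X → X → ℝ) (A : Set X) (r : ℝ) : ℕ∞ :=
  ⨆ (s : Finset X) (_ : (∀ x ∈ s, ball l x r ⊆ A) ∧
    (s : Set X).PairwiseDisjoint (fun x => ball l x r)), (s.card : ℕ∞)

end Dissimilarity

/-! ### Bandit environments -/

section Environment

variable {X : Type*}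

/-- The mean payoff `f x = ∫ y dM_x(y)` of the arm `x`. -/
def meanPayoff (M : X → Measure ℝ) (x : X) : ℝ := ∫ y, y ∂(M x)

/-- The best mean payoff `f* = sup_x f x`. -/
def bestPayoff (f : X → ℝ) : ℝ := ⨆ x, f x

/-- The set of `ε`-optimal arms. -/
def nearOptimal (f : X → ℝ) (ε : ℝ) : Set X := {x | bestPayoff f - ε ≤ f x}

/-- A bandit environment with rewards in `[0, 1]` and a measurable mean-payoff function. -/
structure IsEnvironment [MeasurableSpace X] (M : X → Measure ℝ) : Prop where
  prob : ∀ x, IsProbabilityMeasure (M x)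
  supp : ∀ x, ∀ᵐ y ∂(M x), y ∈ Set.Icc (0 : ℝ) 1
  measurable_meanPayoff : Measurable (meanPayoff M)

end Environment

/-! ### The tree -/

/-- Nodes `(h, i)` of the infinite binary tree; the actual nodes are those with
`1 ≤ i ≤ 2 ^ h`. -/
abbrev Node := ℕ × ℕ

/-- The first child `(h + 1, 2 i - 1)`. -/
def Node.left (v : Node) : Node := (v.1 + 1, 2 * v.2 - 1)

/-- The second child `(h + 1, 2 i)`. -/
def Node.right (v : Node) : Node := (v.1 + 1, 2 * v.2)

/-- `Descendant v w` says that `w` belongs to the set of descendants of `v`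
(every node is its own descendant). -/
inductive Descendant (v : Node) : Node → Prop
  | refl : Descendant v v
  | left {w : Node} : Descendant v w → Descendant v w.left
  | right {w : Node} : Descendant v w → Descendant v w.right

/-- A tree of coverings: measurable regions with `P (0, 1)` the whole space, each region being
the union of the regions of the two children. -/
structure IsTreeOfCoverings {X : Type*} [MeasurableSpace X] (P : Node → Set X) : Prop where
  measurableSet : ∀ h i : ℕ, 1 ≤ i → i ≤ 2 ^ h → MeasurableSet (P (h, i))
  root : P (0, 1) = Set.univ
  split : ∀ h i : ℕ, 1 ≤ i → i ≤ 2 ^ h →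
    P (h, i) = P (h + 1, 2 * i - 1) ∪ P (h + 1, 2 * i)

/-! ### The assumptions -/

section Assumptions

variable {X : Type*}

/-- The regions shrink exactly at a geometric rate: diameters are at most `ν₁ ρ ^ h`, and the
regions of depth `h` contain pairwise disjoint balls of radius `ν₂ ρ ^ h`. -/
def Shrinking (P : Node → Set X) (l : X → X → ℝ) (ν₁ ρ ν₂ : ℝ) : Prop :=
  ∀ h : ℕ,
    (∀ i, 1 ≤ i → i ≤ 2 ^ h → diam l (P (h, i)) ≤ ENNReal.ofReal (ν₁ * ρ ^ h)) ∧
    ∃ c : ℕ → X,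
      (∀ i, 1 ≤ i → i ≤ 2 ^ h → c i ∈ P (h, i) ∧ ball l (c i) (ν₂ * ρ ^ h) ⊆ P (h, i)) ∧
      (∀ i j, 1 ≤ i → i < j → j ≤ 2 ^ h →
        Disjoint (ball l (c i) (ν₂ * ρ ^ h)) (ball l (c j) (ν₂ * ρ ^ h)))

/-- `f` is `ε₀`-locally `L`-weakly Lipschitz with respect to `l`. -/
structure LocallyWeaklyLipschitz (f : X → ℝ) (l : X → X → ℝ) (ε₀ L : ℝ) : Prop where
  optimal : ∀ A : Set X, A.Nonempty → sSup (f '' A) = bestPayoff f →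
    diam l A ≤ ENNReal.ofReal ε₀ →
    ENNReal.ofReal (bestPayoff f - sInf (f '' A)) ≤ diam l A
  near : ∀ x ∈ nearOptimal f ε₀, ∀ ε : ℝ, 0 ≤ ε → ε ≤ ε₀ →
    ball l x (bestPayoff f - f x + ε) ⊆ nearOptimal f (L * (2 * (bestPayoff f - f x) + ε))

/-- The packing bound: for `0 < ε ≤ ε₀`, the `ε`-packing number of the set of `c ε`-optimal arms
is at most `C ε ^ (-d)`. -/
def PackingBound (f : X → ℝ) (l : X → X → ℝ) (ε₀ c C d : ℝ) : Prop :=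
  ∀ ε : ℝ, 0 < ε → ε ≤ ε₀ →
    (packingNumber l (nearOptimal f (c * ε)) ε : ENNReal) ≤ ENNReal.ofReal (C * ε ^ (-d))

end Assumptions

/-! ### The statistics kept by the algorithm

`node t` and `reward t` are the node played and the reward received in round `t + 1`, so that
the quantities after `n` rounds depend on the indices `t < n`. -/

section Statistics

variable (ν₁ ρ : ℝ) (node : ℕ → Node) (reward : ℕ → ℝ)

/-- The tree after `n` rounds: the root and the nodes played so far. -/
def tree (n : ℕ) : Finset Node := insert (0, 1) ((Finset.range n).image node)

open Classical in
/-- `T_v(n)`: how many times a descendant of `v` was played in the first `n` rounds. -/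
def playCount (n : ℕ) (v : Node) : ℕ :=
  ((Finset.range n).filter (fun t => Descendant v (node t))).card

open Classical in
/-- The average of the rewards received in the first `n` rounds when a descendant of `v` was
played. -/
def empMean (n : ℕ) (v : Node) : ℝ :=
  (∑ t ∈ (Finset.range n).filter (fun t => Descendant v (node t)), reward t) /
    (playCount node n v : ℝ)

/-- The `U`-value of `v` after `n` rounds. -/
def uValue (n : ℕ) (v : Node) : EReal :=
  if 0 < playCount node n v then
    ((empMean node reward n v + Real.sqrt (2 * Real.log n / (playCount node n v : ℝ))
      + ν₁ * ρ ^ v.1 : ℝ) : EReal)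
  else ⊤

/-- Auxiliary backward recursion, down to `k` levels below a node. -/
def bAux (T : Finset Node) (U : Node → EReal) : ℕ → Node → EReal
  | 0, _ => ⊤
  | k + 1, v => if v ∈ T then min (U v) (max (bAux T U k v.left) (bAux T U k v.right)) else ⊤

/-- The `B`-values attached to a finite tree `T` and to `U`-values: see `bOf_eq`. -/
def bOf (T : Finset Node) (U : Node → EReal) (v : Node) : EReal :=
  bAux T U (T.sup Prod.fst + 1 - v.1) v

/-- The recursion that defines the `B`-values. -/
theorem bOf_eq (T : Finset Node) (U : Node → EReal) (v : Node) :
    bOf T U v = if v ∈ T then min (U v) (max (bOf T U v.left) (bOf T U v.right)) else ⊤ := by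
  by_cases hv : v ∈ T
  · have h1 : v.1 ≤ T.sup Prod.fst := Finset.le_sup (f := Prod.fst) hv
    have h2 : T.sup Prod.fst + 1 - v.1 = (T.sup Prod.fst - v.1) + 1 := by omega
    have h3 : T.sup Prod.fst + 1 - v.left.1 = T.sup Prod.fst - v.1 := by
      simp only [Node.left]; omega
    have h4 : T.sup Prod.fst + 1 - v.right.1 = T.sup Prod.fst - v.1 := by
      simp only [Node.right]; omega
    simp only [bOf, h2, h3, h4, bAux]
  · simp only [bOf, hv, if_false]
    cases T.sup Prod.fst + 1 - v.1 with
    | zero => rfl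
    | succ k => simp only [bAux, hv, if_false]

/-- The `B`-value of `v` after `n` rounds. -/
def bValue (n : ℕ) (v : Node) : EReal :=
  bOf (tree node n) (uValue ν₁ ρ node reward n) v

end Statistics

/-! ### The algorithm -/

/-- The nodes that a search started at depth `z` can visit: it starts at a node of depth `z` with
the largest `B`-value and, as long as the current node is in the tree `T`, it moves to a child
with the largest `B`-value. Ties may be broken in any way. -/
inductive Visits (z : ℕ) (T : Finset Node) (B : Node → EReal) : Node → Prop
  | start (i : ℕ) (h1 : 1 ≤ i) (h2 : i ≤ 2 ^ z)
      (hmax : ∀ j, 1 ≤ j → j ≤ 2 ^ z → B (z, j) ≤ B (z, i)) : Visits z T B (z, i)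
  | left {v : Node} (hv : Visits z T B v) (hT : v ∈ T) (hB : B v.right ≤ B v.left) :
      Visits z T B v.left
  | right {v : Node} (hv : Visits z T B v) (hT : v ∈ T) (hB : B v.left ≤ B v.right) :
      Visits z T B v.right

/-- The search selects the first visited node outside the tree. -/
def Selects (z : ℕ) (T : Finset Node) (B : Node → EReal) (v : Node) : Prop :=
  Visits z T B v ∧ v ∉ T

section Run

variable {X Ω : Type*} [MeasurableSpace X] [MeasurableSpace Ω]

/-- The information available just before the reward with index `t` is drawn: all earlier nodes,
arms and rewards, and the current node and arm. -/
abbrev history (node : ℕ → Ω → Node) (arm : ℕ → Ω → X) (reward : ℕ → Ω → ℝ) (t : ℕ) :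
    MeasurableSpace Ω :=
  (⨆ s ∈ Set.Iic t, (MeasurableSpace.comap (node s) inferInstance ⊔
    MeasurableSpace.comap (arm s) inferInstance)) ⊔
  (⨆ s ∈ Set.Iio t, MeasurableSpace.comap (reward s) inferInstance)

/-- A run of `z`-HOO (with parameters `ν₁`, `ρ` and the regions `P`) against the environment `M`,
realized on a probability space: in round `t + 1`, the algorithm selects `node t` by means of the
`B`-values computed after `t` rounds, plays an arbitrary point `arm t` of the region of this node,
and receives `reward t`, whose conditional law given the past and the current choice is the law
attached by `M` to the arm played. Tie-breaking and the choice of the point in the region are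
arbitrary; they may be randomized and may depend on the past. -/
structure IsRun (z : ℕ) (ν₁ ρ : ℝ) (P : Node → Set X) (M : X → Measure ℝ) (μ : Measure Ω)
    (node : ℕ → Ω → Node) (arm : ℕ → Ω → X) (reward : ℕ → Ω → ℝ) : Prop where
  measurable_node : ∀ t, Measurable (node t)
  measurable_arm : ∀ t, Measurable (arm t)
  measurable_reward : ∀ t, Measurable (reward t)
  selects : ∀ t ω, Selects z (tree (fun s => node s ω) t)
    (bValue ν₁ ρ (fun s => node s ω) (fun s => reward s ω) t) (node t ω)
  arm_mem : ∀ t ω, arm t ω ∈ P (node t ω)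
  reward_law : ∀ t, ∀ S : Set ℝ, MeasurableSet S →
    μ[(reward t ⁻¹' S).indicator (fun _ => (1 : ℝ)) | history node arm reward t]
      =ᵐ[μ] fun ω => (M (arm t ω)).real S

/-- The cumulative (pseudo-)regret `R_n = n f* - ∑_{t ≤ n} f(X_t)`. -/
def regret (f : X → ℝ) (arm : ℕ → Ω → X) (n : ℕ) (ω : Ω) : ℝ :=
  n * bestPayoff f - ∑ t ∈ Finset.range n, f (arm t ω)

end Run

end HOO

end

/-! Call a node of depth `h` good when the supremum of `f` on its region is within `2ν₁ρ^h` of `f*`.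
From depth `z` on, (A2') bounds the gap of every arm of a good region by `4Lν₁ρ^h`
(`LocallyWeaklyLipschitz.gap_le`). The balls that (A1) puts in good regions therefore lie in
`X_{cε}` with `ε = ν₂ρ^h`, and (A3) bounds the number of good nodes when `ε ≤ ε₀`
(`PackingBound.card_goodNodes_le`).

Fix a cut-off depth `H ≥ z` and walk from depth `z` down to the node selected in a round. Either the
walk meets a first node that is not good, which has depth `z` or a good parent; or the selected node
is good and has depth less than `H`; or the walk reaches a good node of depth `H`. The second case
costs at most `4Lν₁ρ^h` per good node, because no node is selected twice, and the third at most
`4Lν₁ρ^H` per round (`IsRun.regret_le`).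

For the first case, some infinite branch consists of regions with supremum `f*`. By (A2') its
`U`-values from depth `z` on exceed `f*` unless a confidence bound fails. The search follows large
`B`-values, so below a node `w` off this branch it selects only if `U(w) > f*` or such a failure
occurs. Once the regret accumulated below `w`, rather than the number of visits, exceeds `16 ln
n/(ν₁ρ^h)`, the inequality `U(w) > f*` is itself a confidence failure
(`IsSearchRun.confidenceFails`). An exponential supermartingale and union bounds give these failures
probability at most `(t+2)/t³` after `t` rounds, whence `IsRun.integral_regretBelow_le`.

The costs of the depths grow like `r^h` with `r = ρ^{-(d+1)}`, while the term of depth `H` decays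
like `ρ^H`. Balancing them gives the main term.

Two points are delicate. The constant `γ` has a factor `L` even in front of the exploration cost, so
small `L` must be excluded: a good node with a child that is not good forces `L ≥ 1/2` or `L > ρ`.
Moreover (A3) may be unavailable at depth `z`, where `ν₂ρ^z` can exceed `ε₀`. Then `ρ ≤ 1/2`, and
that depth is paid for by the slack in the factor `ρ^{-(d+2)}` and in the term `2^z - 1`. -/

namespace HOO

/-! ### Combinatorics of the tree -/

/-- The parent of a node. -/
def Node.parent (v : Node) : Node := (v.1 - 1, (v.2 + 1) / 2)

/-- The actual nodes of the tree. -/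
def Node.Valid (v : Node) : Prop := 1 ≤ v.2 ∧ v.2 ≤ 2 ^ v.1

namespace Node

@[simp] theorem left_fst (v : Node) : v.left.1 = v.1 + 1 := rfl

@[simp] theorem right_fst (v : Node) : v.right.1 = v.1 + 1 := rfl

@[simp] theorem parent_left (v : Node) : v.left.parent = v := by
  obtain ⟨h, i⟩ := v
  simp only [parent, left, Prod.mk.injEq]
  omega

@[simp] theorem parent_right (v : Node) : v.right.parent = v := by
  obtain ⟨h, i⟩ := v
  simp only [parent, right, Prod.mk.injEq]
  omega

theorem Valid.left {v : Node} (hv : v.Valid) : v.left.Valid := by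
  obtain ⟨h, i⟩ := v
  simp only [Valid, Node.left, pow_succ] at *
  omega

theorem Valid.right {v : Node} (hv : v.Valid) : v.right.Valid := by
  obtain ⟨h, i⟩ := v
  simp only [Valid, Node.right, pow_succ] at *
  omega

theorem Valid.parent {v : Node} (hv : v.Valid) (h0 : 1 ≤ v.1) : v.parent.Valid := by
  obtain ⟨_ | h, i⟩ := v
  · simp at h0
  · simp only [Valid, Node.parent, pow_succ, Nat.add_sub_cancel] at *
    omega

theorem eq_left_or_right_parent {v : Node} (h0 : 1 ≤ v.1) :
    v = v.parent.left ∨ v = v.parent.right := by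
  obtain ⟨_ | h, i⟩ := v
  · simp at h0
  · simp only [parent, left, right, Prod.mk.injEq]
    omega

end Node

theorem Descendant.fst_le {v w : Node} (h : Descendant v w) : v.1 ≤ w.1 := by
  induction h with
  | refl => exact le_rfl
  | left _ ih => simp only [Node.left_fst]; omega
  | right _ ih => simp only [Node.right_fst]; omega

theorem Descendant.valid {v w : Node} (h : Descendant v w) (hv : v.Valid) : w.Valid := by
  induction h with
  | refl => exact hv
  | left _ ih => exact ih.left
  | right _ ih => exact ih.right

theorem Descendant.eq_or_parent {v w : Node} (h : Descendant v w) :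
    v = w ∨ Descendant v w.parent := by
  cases h with
  | refl => exact Or.inl rfl
  | left h => right; simpa using h
  | right h => right; simpa using h

theorem Descendant.eq_of_fst_le {v w : Node} (h : Descendant v w) (h1 : w.1 ≤ v.1) : v = w := by
  cases h with
  | refl => rfl
  | left h => have := h.fst_le; simp only [Node.left_fst] at h1; omega
  | right h => have := h.fst_le; simp only [Node.right_fst] at h1; omega

theorem Descendant.of_parent {v w : Node} (h : Descendant v w.parent) (h0 : 1 ≤ w.1) :
    Descendant v w := by
  rcases Node.eq_left_or_right_parent h0 with h1 | h1
  · rw [h1]; exact h.left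
  · rw [h1]; exact h.right

/-- Following a node downwards from depth `z`, either the property `Q` holds along the whole branch
up to depth `K`, or there is a first node at which it fails. -/
theorem exists_first_failure (Q : Node → Prop) {z K : ℕ} (hzK : z ≤ K) :
    ∀ u : Node, u.Valid → z ≤ u.1 →
      (∃ w : Node, w.Valid ∧ Descendant w u ∧ ¬ Q w ∧ z ≤ w.1 ∧ w.1 ≤ K ∧
        (w.1 = z ∨ (z ≤ w.parent.1 ∧ Q w.parent))) ∨
      (u.1 < K ∧ Q u) ∨
      (∃ w : Node, w.Valid ∧ Descendant w u ∧ w.1 = K ∧ Q w) := by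
  suffices H : ∀ k : ℕ, ∀ u : Node, u.Valid → u.1 = z + k →
      (∃ w : Node, w.Valid ∧ Descendant w u ∧ ¬ Q w ∧ z ≤ w.1 ∧ w.1 ≤ K ∧
        (w.1 = z ∨ (z ≤ w.parent.1 ∧ Q w.parent))) ∨
      (u.1 < K ∧ Q u) ∨
      (∃ w : Node, w.Valid ∧ Descendant w u ∧ w.1 = K ∧ Q w) by
    intro u hu hz
    exact H (u.1 - z) u hu (by omega)
  intro k
  induction k with
  | zero =>
    intro u hu hk
    by_cases hQ : Q u
    · rcases lt_or_ge u.1 K with h | h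
      · exact Or.inr (Or.inl ⟨h, hQ⟩)
      · exact Or.inr (Or.inr ⟨u, hu, .refl, by omega, hQ⟩)
    · exact Or.inl ⟨u, hu, .refl, hQ, by omega, by omega, Or.inl (by omega)⟩
  | succ k ih =>
    intro u hu hk
    have h1 : 1 ≤ u.1 := by omega
    have hp : u.parent.1 = z + k := by simp only [Node.parent]; omega
    rcases ih u.parent (hu.parent h1) hp with ⟨w, a1, a2, a3⟩ | ⟨a1, a2⟩ | ⟨w, a1, a2, a3⟩
    · exact Or.inl ⟨w, a1, a2.of_parent h1, a3⟩
    · by_cases hQ : Q u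
      · rcases lt_or_ge u.1 K with h | h
        · exact Or.inr (Or.inl ⟨h, hQ⟩)
        · exact Or.inr (Or.inr ⟨u, hu, .refl, by omega, hQ⟩)
      · exact Or.inl ⟨u, hu, .refl, hQ, by omega, by omega, Or.inr ⟨by omega, a2⟩⟩
    · exact Or.inr (Or.inr ⟨w, a1, a2.of_parent h1, a3⟩)

/-! ### Nodes visited by a search -/

section Search

variable {z : ℕ} {T : Finset Node} {B : Node → EReal}

theorem Visits.valid {v : Node} (h : Visits z T B v) : v.Valid := by
  induction h with
  | start i h1 h2 _ => exact ⟨h1, h2⟩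
  | left _ _ _ ih => exact ih.left
  | right _ _ _ ih => exact ih.right

theorem Visits.le_fst {v : Node} (h : Visits z T B v) : z ≤ v.1 := by
  induction h with
  | start i h1 h2 _ => exact le_rfl
  | left _ _ _ ih => simp only [Node.left_fst]; omega
  | right _ _ _ ih => simp only [Node.right_fst]; omega

theorem Visits.fst_le {v : Node} (h : Visits z T B v) {m : ℕ} (hm : ∀ w ∈ T, w.1 < m)
    (hz : z ≤ m) : v.1 ≤ m := by
  cases h with
  | start i h1 h2 _ => exact hz
  | left _ hT _ => exact hm _ hT
  | right _ hT _ => exact hm _ hT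

/-- Parents are unique, so the path of the search is the chain of ancestors of its endpoint, and the
search moves on only from nodes of `T`. -/
theorem Visits.of_descendant {u : Node} (h : Visits z T B u) {w : Node} (hw : Descendant w u)
    (hz : z ≤ w.1) : Visits z T B w ∧ (w = u ∨ w ∈ T) := by
  induction h with
  | start i h1 h2 hmax =>
    obtain rfl := hw.eq_of_fst_le hz
    exact ⟨.start i h1 h2 hmax, Or.inl rfl⟩
  | @left v hv hT hB ih =>
    rcases hw.eq_or_parent with rfl | h
    · exact ⟨.left hv hT hB, Or.inl rfl⟩
    · rw [Node.parent_left] at h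
      obtain ⟨h1, h2⟩ := ih h
      refine ⟨h1, Or.inr ?_⟩
      rcases h2 with rfl | h2
      · exact hT
      · exact h2
  | @right v hv hT hB ih =>
    rcases hw.eq_or_parent with rfl | h
    · exact ⟨.right hv hT hB, Or.inl rfl⟩
    · rw [Node.parent_right] at h
      obtain ⟨h1, h2⟩ := ih h
      refine ⟨h1, Or.inr ?_⟩
      rcases h2 with rfl | h2
      · exact hT
      · exact h2

end Search

/-- An infinite branch of the tree. -/
structure IsBranch (o : ℕ → Node) : Prop where
  fst : ∀ k, (o k).1 = k
  valid : ∀ k, (o k).Valid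
  succ : ∀ k, o (k + 1) = (o k).left ∨ o (k + 1) = (o k).right

theorem bOf_le_max_children {T : Finset Node} {U : Node → EReal} {v : Node} (hv : v ∈ T) :
    bOf T U v ≤ max (bOf T U v.left) (bOf T U v.right) := by
  rw [bOf_eq, if_pos hv]; exact min_le_right _ _

theorem bOf_le {T : Finset Node} {U : Node → EReal} {v : Node} (hv : v ∈ T) :
    bOf T U v ≤ U v := by
  rw [bOf_eq, if_pos hv]; exact min_le_left _ _

/-- A visited node outside of a branch has a `B`-value at least as large as some node of the
branch. -/
theorem Visits.exists_branch_le {z : ℕ} {T : Finset Node} {U : Node → EReal} {o : ℕ → Node}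
    (ho : IsBranch o) {v : Node} (h : Visits z T (bOf T U) v) (hv : v ≠ o v.1) :
    ∃ k, z ≤ k ∧ bOf T U (o k) ≤ bOf T U v := by
  induction h with
  | start i h1 h2 hmax =>
    refine ⟨z, le_rfl, ?_⟩
    have h3 := ho.valid z
    have h4 := ho.fst z
    have h5 : o z = (z, (o z).2) := Prod.ext h4 rfl
    rw [h5]
    refine hmax _ h3.1 ?_
    have := h3.2
    rwa [h4] at this
  | @left v hv' hT hB ih =>
    -- If the path leaves the branch here, the sibling just rejected is on the branch. If it left
    -- earlier, the chosen child attains the maximum in the recursion, so `B`-values no longer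
    -- decrease along the path.
    by_cases hvo : v = o v.1
    · refine ⟨v.1 + 1, hv'.le_fst.trans (Nat.le_succ _), ?_⟩
      rcases ho.succ v.1 with h1 | h1
      · rw [← hvo] at h1
        exact absurd h1.symm hv
      · rw [← hvo] at h1
        rw [h1]; exact hB
    · obtain ⟨k, hk, hle⟩ := ih hvo
      exact ⟨k, hk, hle.trans ((bOf_le_max_children hT).trans (max_le le_rfl hB))⟩
  | @right v hv' hT hB ih =>
    by_cases hvo : v = o v.1
    · refine ⟨v.1 + 1, hv'.le_fst.trans (Nat.le_succ _), ?_⟩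
      rcases ho.succ v.1 with h1 | h1
      · rw [← hvo] at h1
        rw [h1]; exact hB
      · rw [← hvo] at h1
        exact absurd h1.symm hv
    · obtain ⟨k, hk, hle⟩ := ih hvo
      exact ⟨k, hk, hle.trans ((bOf_le_max_children hT).trans (max_le hB le_rfl))⟩

/-- If the `U`-values exceed a level along a branch, so do the `B`-values. -/
theorem IsBranch.lt_bOf {o : ℕ → Node} (ho : IsBranch o) {T : Finset Node} {U : Node → EReal}
    {z : ℕ} {x : ℝ} (hU : ∀ k, z ≤ k → (x : EReal) < U (o k)) {k : ℕ} (hk : z ≤ k) :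
    (x : EReal) < bOf T U (o k) := by
  -- The recursion takes a maximum over two children, one of which continues the branch; outside `T`
  -- and at recursion depth `0` the value is `⊤`.
  have H : ∀ m k, z ≤ k → (x : EReal) < bAux T U m (o k) := by
    intro m
    induction m with
    | zero => intro k _; exact EReal.coe_lt_top x
    | succ m ih =>
      intro k hk
      rw [bAux]
      split_ifs
      · refine lt_min (hU k hk) ?_
        have h1 := ih (k + 1) (by omega)
        rcases ho.succ k with h | h
        · rw [h] at h1; exact lt_max_of_lt_left h1
        · rw [h] at h1; exact lt_max_of_lt_right h1
      · exact EReal.coe_lt_top x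
  exact H _ k hk

/-! ### Runs of the search -/

/-- The nodes are selected by successive searches, for some `B`-values coming from `U`-values. -/
def IsSearchRun (z : ℕ) (U : ℕ → Node → EReal) (node : ℕ → Node) : Prop :=
  ∀ t, Selects z (tree node t) (bOf (tree node t) (U t)) (node t)

theorem mem_tree_of_lt {node : ℕ → Node} {s t : ℕ} (h : s < t) : node s ∈ tree node t :=
  Finset.mem_insert_of_mem (Finset.mem_image_of_mem _ (Finset.mem_range.2 h))

theorem tree_mono {node : ℕ → Node} {s t : ℕ} (h : s ≤ t) : tree node s ⊆ tree node t :=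
  Finset.insert_subset_insert _ (Finset.image_subset_image (Finset.range_mono h))

namespace IsSearchRun

variable {z : ℕ} {U : ℕ → Node → EReal} {node : ℕ → Node} (hr : IsSearchRun z U node)
include hr

theorem valid (t : ℕ) : (node t).Valid := (hr t).1.valid

theorem le_fst (t : ℕ) : z ≤ (node t).1 := (hr t).1.le_fst

theorem injective : Function.Injective node := by
  have H : ∀ s t, s < t → node s ≠ node t := fun s t h he =>
    (hr t).2 (he ▸ mem_tree_of_lt h)
  intro s t he
  rcases lt_trichotomy s t with h | h | h
  · exact absurd he (H s t h)
  · exact h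
  · exact absurd he.symm (H t s h)

/-- A search ends at most one level below the tree. The extra `1` is due to the root, which is in
the tree before the first round, even when `z = 0`. -/
theorem fst_le (t : ℕ) : (node t).1 ≤ z + t + 1 := by
  induction t using Nat.strong_induction_on with
  | _ t ih =>
    refine (hr t).1.fst_le ?_ (by omega)
    intro w hw
    rcases Finset.mem_insert.1 hw with rfl | hw
    · exact Nat.succ_pos _
    · obtain ⟨s, hs, rfl⟩ := Finset.mem_image.1 hw
      have h1 := Finset.mem_range.1 hs
      have := ih s h1
      omega

/-- A search passing through `w` either stops there, which adds `w` to the tree, or goes on because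
`w` is already in it. This makes `B(w) ≤ U(w)` available. -/
theorem mem_tree_of_playCount_pos {w : Node} (hz : z ≤ w.1) {t : ℕ}
    (h : 0 < playCount node t w) : w ∈ tree node t := by
  classical
  obtain ⟨s, hs⟩ := Finset.card_pos.1 h
  obtain ⟨h1, h2⟩ := Finset.mem_filter.1 hs
  have h3 := Finset.mem_range.1 h1
  rcases ((hr s).1.of_descendant h2 hz).2 with rfl | h4
  · exact mem_tree_of_lt h3
  · exact tree_mono h3.le h4

/-- If a descendant of a node `w` outside of a branch is selected, then either some `U`-value on the
branch is low or the `U`-value of `w` is large. -/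
theorem exists_branch_le_or_lt {o : ℕ → Node} (ho : IsBranch o) {w : Node} (hz : z ≤ w.1)
    (hw : w ≠ o w.1) {t : ℕ} (hsel : Descendant w (node t)) (hc : 0 < playCount node t w) (x : ℝ) :
    (∃ k, z ≤ k ∧ U t (o k) ≤ (x : EReal)) ∨ (x : EReal) < U t w := by
  by_contra! hcon
  obtain ⟨h1, h2⟩ := hcon
  have hv := ((hr t).1.of_descendant hsel hz).1
  obtain ⟨k, hk, hle⟩ := hv.exists_branch_le ho hw
  have h3 := ho.lt_bOf (T := tree node t) h1 hk
  exact absurd ((h3.trans_le hle).trans_le ((bOf_le (hr.mem_tree_of_playCount_pos hz hc)).trans h2))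
    (lt_irrefl _)

end IsSearchRun


/-! ### Deviations of the rewards -/

section ConditionalLaw

open ProbabilityTheory

/-- If `ν` gives the conditional law of the real random variable `Y` given `Z`, then expectations
of functions of `Z` and `Y` are obtained by first integrating over `Y` with respect to `ν`. -/
theorem lintegral_of_conditional_law {Ω β : Type*} [MeasurableSpace Ω] [mβ : MeasurableSpace β]
    {μ : Measure Ω} [IsProbabilityMeasure μ] {Z : Ω → β} (hZ : Measurable Z) {Y : Ω → ℝ}
    (hY : Measurable Y) {ν : Ω → Measure ℝ} (hν : ∀ ω, IsProbabilityMeasure (ν ω))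
    (hlaw : ∀ S : Set ℝ, MeasurableSet S →
      μ[(Y ⁻¹' S).indicator (fun _ => (1 : ℝ)) | mβ.comap Z] =ᵐ[μ] fun ω => (ν ω).real S)
    {F : β × ℝ → ENNReal} (hF : Measurable F) :
    ∫⁻ ω, F (Z ω, Y ω) ∂μ = ∫⁻ ω, ∫⁻ y, F (Z ω, y) ∂(ν ω) ∂μ := by
  -- The family `ν` is not assumed to be a kernel. It is identified with the regular conditional
  -- distribution through the countably many rational intervals, which determine a law on the line.
  have h1 : ∀ᵐ ω ∂μ, condDistrib Y Z μ (Z ω) = ν ω := by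
    have h2 : ∀ᵐ ω ∂μ, ∀ p q : ℚ, (condDistrib Y Z μ (Z ω)).real (Set.Ioo (p : ℝ) q) =
        (ν ω).real (Set.Ioo (p : ℝ) q) := by
      refine ae_all_iff.2 fun p => ae_all_iff.2 fun q => ?_
      have h3 := condDistrib_ae_eq_condExp (μ := μ) hZ hY
        (measurableSet_Ioo (a := (p : ℝ)) (b := (q : ℝ)))
      exact h3.trans (hlaw _ measurableSet_Ioo)
    filter_upwards [h2] with ω hω
    have := hν ω
    refine Real.measure_ext_Ioo_rat fun p q => ?_
    have h3 := hω p q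
    rwa [measureReal_def, measureReal_def,
      ENNReal.toReal_eq_toReal_iff' (measure_ne_top _ _) (measure_ne_top _ _)] at h3
  have h2 : ∫⁻ ω, F (Z ω, Y ω) ∂μ = ∫⁻ x, F x ∂(μ.map fun ω => (Z ω, Y ω)) :=
    (lintegral_map hF (hZ.prodMk hY)).symm
  rw [h2, ← compProd_map_condDistrib hY.aemeasurable, Measure.lintegral_compProd hF,
    lintegral_map hF.lintegral_kernel_prod_right' hZ]
  refine lintegral_congr_ae ?_
  filter_upwards [h1] with ω hω
  rw [hω]

/-- Hoeffding's lemma for a law on `[0, 1]`. -/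
theorem lintegral_exp_sub_mean_le {ν : Measure ℝ} [IsProbabilityMeasure ν]
    (h : ∀ᵐ y ∂ν, y ∈ Set.Icc (0 : ℝ) 1) (lam : ℝ) :
    ∫⁻ y, ENNReal.ofReal (Real.exp (lam * (y - ∫ u, u ∂ν) - lam ^ 2 / 8)) ∂ν ≤ 1 := by
  have hs := hasSubgaussianMGF_of_mem_Icc (X := fun y : ℝ => y) (μ := ν) aemeasurable_id h
  have h1 := hs.mgf_le lam
  have h2 := hs.integrable_exp_mul lam
  have h3 : ∀ y : ℝ, Real.exp (lam * (y - ∫ u, u ∂ν) - lam ^ 2 / 8) =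
      Real.exp (lam * (y - ∫ u, u ∂ν)) * Real.exp (-(lam ^ 2 / 8)) := fun y => by
    rw [← Real.exp_add]; congr 1
  simp_rw [h3]
  rw [← ofReal_integral_eq_lintegral_ofReal (h2.mul_const _)
    (Filter.Eventually.of_forall fun y => by positivity), integral_mul_const]
  rw [← ENNReal.ofReal_one]
  refine ENNReal.ofReal_le_ofReal ?_
  have h4 : ∫ y, Real.exp (lam * (y - ∫ u, u ∂ν)) ∂ν ≤ Real.exp (lam ^ 2 / 8) := by
    refine h1.trans (le_of_eq ?_)
    congr 1
    norm_num
    ring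
  calc _ ≤ Real.exp (lam ^ 2 / 8) * Real.exp (-(lam ^ 2 / 8)) := by gcongr
    _ = 1 := by rw [← Real.exp_add]; simp

end ConditionalLaw

open Classical in
/-- The sum of the deviations of the rewards from their means over the rounds among the first `t`
in which a descendant of `v` was played. -/
noncomputable def deviation {X : Type*} (f : X → ℝ) (node : ℕ → Node) (arm : ℕ → X) (reward : ℕ → ℝ)
    (t : ℕ) (v : Node) : ℝ :=
  ∑ s ∈ (Finset.range t).filter (fun s => Descendant v (node s)), (reward s - f (arm s))

open Classical in
theorem playCount_succ (node : ℕ → Node) (t : ℕ) (v : Node) :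
    playCount node (t + 1) v = playCount node t v + if Descendant v (node t) then 1 else 0 := by
  unfold playCount
  rw [Finset.range_add_one, Finset.filter_insert]
  split_ifs
  · rw [Finset.card_insert_of_notMem (by simp)]
  · rfl

theorem playCount_le (node : ℕ → Node) (t : ℕ) (v : Node) : playCount node t v ≤ t := by
  classical
  exact (Finset.card_filter_le _ _).trans (by simp)

open Classical in
theorem deviation_succ {X : Type*} (f : X → ℝ) (node : ℕ → Node) (arm : ℕ → X) (reward : ℕ → ℝ)
    (t : ℕ) (v : Node) :
    deviation f node arm reward (t + 1) v = deviation f node arm reward t v +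
      if Descendant v (node t) then reward t - f (arm t) else 0 := by
  unfold deviation
  rw [Finset.range_add_one, Finset.filter_insert]
  split_ifs
  · rw [Finset.sum_insert (by simp), add_comm]
  · simp

/-! ### Exponential supermartingale and confidence bounds -/

section Run

variable {X Ω : Type*} [MeasurableSpace X] {node : ℕ → Ω → Node} {arm : ℕ → Ω → X} {reward : ℕ → Ω → ℝ}

theorem measurable_history_node {s t : ℕ} (h : s ≤ t) :
    Measurable[history node arm reward t] (node s) := by
  refine measurable_iff_comap_le.2 ?_
  refine le_trans ?_ le_sup_left
  exact le_trans le_sup_left (le_iSup₂_of_le s h le_rfl)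

theorem measurable_history_arm {s t : ℕ} (h : s ≤ t) :
    Measurable[history node arm reward t] (arm s) := by
  refine measurable_iff_comap_le.2 ?_
  refine le_trans ?_ le_sup_left
  exact le_trans le_sup_right (le_iSup₂_of_le s h le_rfl)

theorem measurable_history_reward {s t : ℕ} (h : s < t) :
    Measurable[history node arm reward t] (reward s) := by
  refine measurable_iff_comap_le.2 ?_
  refine le_trans ?_ le_sup_right
  exact le_iSup₂_of_le s h le_rfl

theorem measurable_playCount {m : MeasurableSpace Ω} {t : ℕ}
    (hn : ∀ s < t, Measurable[m] (node s)) (v : Node) :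
    Measurable[m] fun ω => playCount (fun s => node s ω) t v := by
  classical
  induction t with
  | zero => simp only [playCount, Finset.range_zero, Finset.filter_empty, Finset.card_empty]
            exact measurable_const
  | succ t ih =>
    simp_rw [playCount_succ]
    refine (ih fun s hs => hn s (by omega)).add ?_
    exact (Measurable.of_discrete (f := fun u : Node => if Descendant v u then 1 else 0)).comp
      (hn t (by omega))

theorem measurable_deviation {m : MeasurableSpace Ω} {f : X → ℝ} (hf : Measurable f) {t : ℕ}
    (hn : ∀ s < t, Measurable[m] (node s)) (ha : ∀ s < t, Measurable[m] (arm s))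
    (hr : ∀ s < t, Measurable[m] (reward s)) (v : Node) :
    Measurable[m] fun ω => deviation f (fun s => node s ω) (fun s => arm s ω)
      (fun s => reward s ω) t v := by
  classical
  induction t with
  | zero => simp only [deviation, Finset.range_zero, Finset.filter_empty, Finset.sum_empty]
            exact measurable_const
  | succ t ih =>
    simp_rw [deviation_succ]
    refine (ih (fun s hs => hn s (by omega)) (fun s hs => ha s (by omega))
      (fun s hs => hr s (by omega))).add ?_
    refine Measurable.ite ?_ ((hr t (by omega)).sub (hf.comp (ha t (by omega)))) measurable_const
    exact hn t (by omega) (MeasurableSet.of_discrete (s := {u : Node | Descendant v u}))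

variable [MeasurableSpace Ω] {μ : Measure Ω}
  {M : X → Measure ℝ} {z : ℕ} {ν₁ ρ : ℝ} {P : Node → Set X}

theorem IsRun.history_le (hrun : IsRun z ν₁ ρ P M μ node arm reward) (t : ℕ) :
    history node arm reward t ≤ ‹MeasurableSpace Ω› := by
  refine sup_le (iSup₂_le fun s _ => sup_le ?_ ?_) (iSup₂_le fun s _ => ?_)
  · exact (hrun.measurable_node s).comap_le
  · exact (hrun.measurable_arm s).comap_le
  · exact (hrun.measurable_reward s).comap_le

/-- The exponential supermartingale of the deviations. -/
theorem lintegral_exp_deviation_le [IsProbabilityMeasure μ] (hM : IsEnvironment M)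
    (hrun : IsRun z ν₁ ρ P M μ node arm reward) (v : Node) (lam : ℝ) (t : ℕ) :
    ∫⁻ ω, ENNReal.ofReal (Real.exp (lam * deviation (meanPayoff M) (fun s => node s ω)
      (fun s => arm s ω) (fun s => reward s ω) t v -
        lam ^ 2 / 8 * (playCount (fun s => node s ω) t v : ℝ))) ∂μ ≤ 1 := by
  classical
  induction t with
  | zero => simp [deviation, playCount]
  | succ t ih =>
    refine le_trans ?_ ih
    set G : Ω → ℝ := fun ω => lam * deviation (meanPayoff M) (fun s => node s ω)
      (fun s => arm s ω) (fun s => reward s ω) t v -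
        lam ^ 2 / 8 * (playCount (fun s => node s ω) t v : ℝ) with hG
    have hGm : Measurable[history node arm reward t] G := by
      refine Measurable.sub ?_ ?_
      · exact (measurable_deviation hM.measurable_meanPayoff
          (fun s hs => measurable_history_node hs.le) (fun s hs => measurable_history_arm hs.le)
          (fun s hs => measurable_history_reward hs) v).const_mul _
      · refine Measurable.const_mul ?_ _
        exact (Measurable.of_discrete (f := fun k : ℕ => (k : ℝ))).comp
          (measurable_playCount (fun s hs => measurable_history_node hs.le) v)
    set F : Ω × ℝ → ENNReal := fun p => ENNReal.ofReal (Real.exp (G p.1 +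
      if Descendant v (node t p.1) then
        lam * (p.2 - meanPayoff M (arm t p.1)) - lam ^ 2 / 8 else 0)) with hFdef
    have hF : Measurable[(history node arm reward t).prod (borel ℝ)] F := by
      let _ : MeasurableSpace Ω := history node arm reward t
      have h1 : Measurable (fun p : Ω × ℝ => G p.1) := hGm.comp measurable_fst
      have h2 : Measurable (fun p : Ω × ℝ => meanPayoff M (arm t p.1)) :=
        (hM.measurable_meanPayoff.comp (measurable_history_arm le_rfl)).comp measurable_fst
      have h3 : MeasurableSet {p : Ω × ℝ | Descendant v (node t p.1)} :=
        ((measurable_history_node (node := node) (arm := arm) (reward := reward) le_rfl).comp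
          (measurable_fst (β := ℝ)))
          (MeasurableSet.of_discrete (s := {u : Node | Descendant v u}))
      have h4 : Measurable (fun p : Ω × ℝ => if Descendant v (node t p.1) then
        lam * (p.2 - meanPayoff M (arm t p.1)) - lam ^ 2 / 8 else 0) :=
        Measurable.ite h3 (((measurable_snd.sub h2).const_mul _).sub_const _) measurable_const
      exact (Real.measurable_exp.comp (h1.add h4)).ennreal_ofReal
    -- The conditioning variable is the identity, from `Ω` with its full σ-algebra to `Ω` with the
    -- history. The current node and arm belong to the history, so only the new reward is
    -- integrated.
    have key := @lintegral_of_conditional_law Ω Ω _ (history node arm reward t) μ _ id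
      (measurable_id'' (hrun.history_le t)) (reward t) (hrun.measurable_reward t)
      (fun ω => M (arm t ω)) (fun ω => hM.prob _)
      (fun S hS => by rw [MeasurableSpace.comap_id]; exact hrun.reward_law t S hS) F hF
    calc _ = ∫⁻ ω, F (id ω, reward t ω) ∂μ := by
          refine lintegral_congr fun ω => ?_
          simp only [hFdef, hG, id, playCount_succ, deviation_succ]
          congr 2
          split_ifs
          · push_cast; ring
          · push_cast; ring
      _ = _ := key
      _ ≤ _ := by
          refine lintegral_mono fun ω => ?_
          have := hM.prob (arm t ω)
          simp only [hFdef, id]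
          split_ifs
          · simp_rw [Real.exp_add, ENNReal.ofReal_mul (Real.exp_pos _).le]
            rw [lintegral_const_mul' _ _ ENNReal.ofReal_ne_top]
            exact mul_le_of_le_one_right' (lintegral_exp_sub_mean_le (hM.supp _) lam)
          · simp [hG]

/-- Chernoff's bound for the deviations when `v` was played a given number of times. -/
theorem measure_deviation_ge_le [IsProbabilityMeasure μ] (hM : IsEnvironment M)
    (hrun : IsRun z ν₁ ρ P M μ node arm reward) (v : Node) {ε : ℝ} (hε : ε ^ 2 = 1)
    {t j : ℕ} (ht : 1 ≤ t) (hj : 0 < j) :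
    μ {ω | playCount (fun s => node s ω) t v = j ∧ Real.sqrt (2 * j * Real.log t) ≤
      ε * deviation (meanPayoff M) (fun s => node s ω)
      (fun s => arm s ω) (fun s => reward s ω) t v} ≤ ENNReal.ofReal (1 / (t : ℝ) ^ 4) := by
  have ht0 : (0 : ℝ) < t := by exact_mod_cast ht
  have hj0 : (0 : ℝ) < j := by exact_mod_cast hj
  have hlog : 0 ≤ Real.log t := Real.log_nonneg (by exact_mod_cast ht)
  set x := Real.sqrt (2 * j * Real.log t) with hx
  have hx2 : x ^ 2 = 2 * j * Real.log t := Real.sq_sqrt (by positivity)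
  have hx0 : 0 ≤ x := Real.sqrt_nonneg _
  -- Up to the sign `ε`, which selects the tail, this maximizes `λx - λ²j/8`; the maximum is `2x²/j
  -- = 4 ln t`.
  set lam : ℝ := ε * (4 * x / j) with hlam
  have hE := lintegral_exp_deviation_le hM hrun v lam t
  set g : Ω → ENNReal := fun ω => ENNReal.ofReal (Real.exp (lam * deviation (meanPayoff M)
    (fun s => node s ω) (fun s => arm s ω) (fun s => reward s ω) t v -
        lam ^ 2 / 8 * (playCount (fun s => node s ω) t v : ℝ))) with hg
  have hgm : Measurable g := by
    refine (Real.measurable_exp.comp (Measurable.sub ?_ ?_)).ennreal_ofReal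
    · exact (measurable_deviation hM.measurable_meanPayoff (fun s _ => hrun.measurable_node s)
        (fun s _ => hrun.measurable_arm s) (fun s _ => hrun.measurable_reward s) v).const_mul _
    · refine Measurable.const_mul ?_ _
      exact (Measurable.of_discrete (f := fun k : ℕ => (k : ℝ))).comp
        (measurable_playCount (fun s _ => hrun.measurable_node s) v)
  have hsub : {ω | playCount (fun s => node s ω) t v = j ∧ x ≤
      ε * deviation (meanPayoff M) (fun s => node s ω)
      (fun s => arm s ω) (fun s => reward s ω) t v} ⊆ {ω | ENNReal.ofReal ((t : ℝ) ^ 4) ≤ g ω} := by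
    rintro ω ⟨h1, h2⟩
    refine ENNReal.ofReal_le_ofReal ?_
    rw [h1]
    have h3 : (t : ℝ) ^ 4 = Real.exp (4 * Real.log t) := by
      rw [mul_comm, Real.exp_mul, Real.exp_log ht0]; norm_cast
    rw [h3]
    refine Real.exp_le_exp.2 ?_
    set D := deviation (meanPayoff M) (fun s => node s ω)
      (fun s => arm s ω) (fun s => reward s ω) t v
    have h4 : lam ^ 2 / 8 * j = 2 * x ^ 2 / j := by
      rw [hlam, mul_pow, hε]; field_simp; ring
    have h5 : lam * D = 4 * x / j * (ε * D) := by rw [hlam]; ring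
    have h6 : 4 * x / j * x ≤ 4 * x / j * (ε * D) := by gcongr
    have h7 : 2 * x ^ 2 / j = 4 * Real.log t := by rw [hx2]; field_simp; ring
    have h8 : 4 * x / j * x = 2 * (2 * x ^ 2 / j) := by ring
    rw [h4, h5, h7]
    rw [h8, h7] at h6
    linarith
  refine (measure_mono hsub).trans ?_
  have h9 := mul_meas_ge_le_lintegral hgm (ENNReal.ofReal ((t : ℝ) ^ 4)) (μ := μ)
  have h10 := h9.trans hE
  rw [one_div, ENNReal.ofReal_inv_of_pos (by positivity)]
  rw [ENNReal.le_inv_iff_mul_le, mul_comm]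
  exact h10

/-- The probability that the rewards obtained below `v` deviate by more than the confidence
width. -/
theorem measure_confidence_le [IsProbabilityMeasure μ] (hM : IsEnvironment M)
    (hrun : IsRun z ν₁ ρ P M μ node arm reward) (v : Node) {ε : ℝ} (hε : ε ^ 2 = 1)
    {t : ℕ} (ht : 1 ≤ t) :
    μ {ω | 0 < playCount (fun s => node s ω) t v ∧
      Real.sqrt (2 * (playCount (fun s => node s ω) t v : ℝ) * Real.log t) ≤
      ε * deviation (meanPayoff M) (fun s => node s ω)
      (fun s => arm s ω) (fun s => reward s ω) t v} ≤ ENNReal.ofReal (1 / (t : ℝ) ^ 3) := by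
  have ht0 : (0 : ℝ) < t := by exact_mod_cast ht
  -- The count is random; the union over its at most `t` positive values turns `t⁻⁴` into `t⁻³`.
  have hsub : {ω | 0 < playCount (fun s => node s ω) t v ∧
      Real.sqrt (2 * (playCount (fun s => node s ω) t v : ℝ) * Real.log t) ≤
      ε * deviation (meanPayoff M) (fun s => node s ω)
      (fun s => arm s ω) (fun s => reward s ω) t v} ⊆
      ⋃ j ∈ Finset.Icc 1 t, {ω | playCount (fun s => node s ω) t v = j ∧
        Real.sqrt (2 * j * Real.log t) ≤ ε * deviation (meanPayoff M) (fun s => node s ω)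
      (fun s => arm s ω) (fun s => reward s ω) t v} := by
    rintro ω ⟨h1, h2⟩
    refine Set.mem_iUnion₂.2 ⟨_, Finset.mem_Icc.2 ⟨h1, playCount_le _ _ _⟩, rfl, h2⟩
  refine (measure_mono hsub).trans ((measure_biUnion_finset_le _ _).trans ?_)
  refine (Finset.sum_le_sum fun j hj =>
    measure_deviation_ge_le hM hrun v hε ht (Finset.mem_Icc.1 hj).1).trans ?_
  rw [Finset.sum_const, Nat.card_Icc, Nat.add_sub_cancel, nsmul_eq_mul,
    ← ENNReal.ofReal_natCast, ← ENNReal.ofReal_mul ht0.le]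
  refine ENNReal.ofReal_le_ofReal (le_of_eq ?_)
  field_simp

end Run


/-! ### Regret accumulated in a suboptimal region -/

section Payoff

variable {X : Type*} [MeasurableSpace X] {M : X → Measure ℝ}

theorem IsEnvironment.meanPayoff_mem (hM : IsEnvironment M) (x : X) :
    meanPayoff M x ∈ Set.Icc (0 : ℝ) 1 := by
  have := hM.prob x
  have hint : Integrable (fun y : ℝ => y) (M x) :=
    Integrable.of_mem_Icc 0 1 aemeasurable_id (hM.supp x)
  constructor
  · exact integral_nonneg_of_ae ((hM.supp x).mono fun y hy => hy.1)
  · have h := integral_mono_ae hint (integrable_const 1) ((hM.supp x).mono fun y hy => hy.2)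
    simpa [meanPayoff] using h

theorem IsEnvironment.bddAbove (hM : IsEnvironment M) (A : Set X) :
    BddAbove (meanPayoff M '' A) :=
  ⟨1, by rintro _ ⟨x, _, rfl⟩; exact (hM.meanPayoff_mem x).2⟩

theorem IsEnvironment.bddBelow (hM : IsEnvironment M) (A : Set X) :
    BddBelow (meanPayoff M '' A) :=
  ⟨0, by rintro _ ⟨x, _, rfl⟩; exact (hM.meanPayoff_mem x).1⟩

theorem IsEnvironment.le_bestPayoff (hM : IsEnvironment M) (x : X) :
    meanPayoff M x ≤ bestPayoff (meanPayoff M) :=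
  le_ciSup (f := meanPayoff M) ⟨1, by rintro _ ⟨x, rfl⟩; exact (hM.meanPayoff_mem x).2⟩ x

theorem IsEnvironment.bestPayoff_le_one (hM : IsEnvironment M) :
    bestPayoff (meanPayoff M) ≤ 1 :=
  Real.iSup_le (fun x => (hM.meanPayoff_mem x).2) zero_le_one

theorem IsEnvironment.gap_le_one (hM : IsEnvironment M) (x : X) :
    bestPayoff (meanPayoff M) - meanPayoff M x ≤ 1 := by
  linarith [hM.bestPayoff_le_one, (hM.meanPayoff_mem x).1]

end Payoff

theorem IsTreeOfCoverings.subset_of_descendant {X : Type*} [MeasurableSpace X] {P : Node → Set X}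
    (hP : IsTreeOfCoverings P) {v w : Node} (h : Descendant v w) (hv : v.Valid) : P w ⊆ P v := by
  induction h with
  | refl => exact subset_rfl
  | @left w h ih =>
    have hw := h.valid hv
    refine subset_trans ?_ ih
    rw [show P w = _ from hP.split w.1 w.2 hw.1 hw.2]
    exact Set.subset_union_left
  | @right w h ih =>
    have hw := h.valid hv
    refine subset_trans ?_ ih
    rw [show P w = _ from hP.split w.1 w.2 hw.1 hw.2]
    exact Set.subset_union_right

open Classical in
/-- The regret accumulated during the rounds among the first `t` in which a descendant of `v` was
played. -/
noncomputable def regretBelow {X : Type*} (f : X → ℝ) (node : ℕ → Node) (arm : ℕ → X) (t : ℕ)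
    (v : Node) : ℝ :=
  ∑ s ∈ (Finset.range t).filter (fun s => Descendant v (node s)), (bestPayoff f - f (arm s))

open Classical in
theorem regretBelow_succ {X : Type*} (f : X → ℝ) (node : ℕ → Node) (arm : ℕ → X)
    (t : ℕ) (v : Node) :
    regretBelow f node arm (t + 1) v = regretBelow f node arm t v +
      if Descendant v (node t) then bestPayoff f - f (arm t) else 0 := by
  unfold regretBelow
  rw [Finset.range_add_one, Finset.filter_insert]
  split_ifs
  · rw [Finset.sum_insert (by simp), add_comm]
  · simp

theorem regretBelow_le {X : Type*} {f : X → ℝ} {node : ℕ → Node} {arm : ℕ → X} {t : ℕ} {v : Node}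
    {D : ℝ} (h : ∀ s, Descendant v (node s) → bestPayoff f - f (arm s) ≤ D) :
    regretBelow f node arm t v ≤ playCount node t v * D := by
  classical
  unfold regretBelow playCount
  rw [← nsmul_eq_mul]
  exact Finset.sum_le_card_nsmul _ _ _ fun s hs => h s (Finset.mem_filter.1 hs).2

theorem le_regretBelow {X : Type*} {f : X → ℝ} {node : ℕ → Node} {arm : ℕ → X} {t : ℕ} {v : Node}
    {D : ℝ} (h : ∀ s, Descendant v (node s) → D ≤ bestPayoff f - f (arm s)) :
    playCount node t v * D ≤ regretBelow f node arm t v := by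
  classical
  unfold regretBelow playCount
  rw [← nsmul_eq_mul]
  exact Finset.card_nsmul_le_sum _ _ _ fun s hs => h s (Finset.mem_filter.1 hs).2

theorem uValue_eq_top {ν₁ ρ : ℝ} {node : ℕ → Node} {reward : ℕ → ℝ} {t : ℕ} {v : Node}
    (h : ¬ 0 < playCount node t v) : uValue ν₁ ρ node reward t v = ⊤ := if_neg h

/-- Comparing `U` with `f*` becomes a question about the sign of a sum in which noise, accumulated
regret, confidence width and diameter are separate terms. -/
theorem uValue_eq {X : Type*} (f : X → ℝ) {ν₁ ρ : ℝ} {node : ℕ → Node} (arm : ℕ → X)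
    {reward : ℕ → ℝ} {t : ℕ} {v : Node} (h : 0 < playCount node t v) :
    uValue ν₁ ρ node reward t v = ((bestPayoff f +
      (deviation f node arm reward t v - regretBelow f node arm t v +
        Real.sqrt (2 * (playCount node t v : ℝ) * Real.log t) +
          playCount node t v * (ν₁ * ρ ^ v.1)) / playCount node t v : ℝ) : EReal) := by
  classical
  rw [uValue, if_pos h]
  congr 1
  set N := playCount node t v with hN
  have hN0 : (0 : ℝ) < N := by exact_mod_cast h
  have h1 : empMean node reward t v * N = N * bestPayoff f + deviation f node arm reward t v -
      regretBelow f node arm t v := by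
    rw [empMean, div_mul_cancel₀ _ hN0.ne', hN, playCount, deviation, regretBelow,
      ← nsmul_eq_mul, ← Finset.sum_const, ← Finset.sum_add_distrib, ← Finset.sum_sub_distrib]
    refine Finset.sum_congr rfl fun s _ => ?_
    ring
  have h2 : Real.sqrt (2 * Real.log t / N) = Real.sqrt (2 * N * Real.log t) / N := by
    rw [show 2 * Real.log t / (N : ℝ) = 2 * N * Real.log t / (N : ℝ) ^ 2 by field_simp,
      Real.sqrt_div' _ (by positivity), Real.sqrt_sq hN0.le]
  rw [h2]
  field_simp
  linear_combination h1

/-- The rewards collected below `v` deviate by more than the confidence width, on the side given by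
the sign `ε`. -/
def ConfidenceFails {X : Type*} (f : X → ℝ) (node : ℕ → Node) (arm : ℕ → X) (reward : ℕ → ℝ)
    (ε : ℝ) (t : ℕ) (v : Node) : Prop :=
  0 < playCount node t v ∧ Real.sqrt (2 * (playCount node t v : ℝ) * Real.log t) ≤
    ε * deviation f node arm reward t v

/-- Once the regret accumulated below a suboptimal node exceeds a threshold, its descendants can be
selected only when some confidence bound fails. -/
theorem IsSearchRun.confidenceFails {X : Type*} {f : X → ℝ} {node : ℕ → Node}
    {arm : ℕ → X} {reward : ℕ → ℝ} {z : ℕ} {ν₁ ρ : ℝ} (hν₁ : 0 < ν₁) (hρ₀ : 0 < ρ)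
    (hr : IsSearchRun z (uValue ν₁ ρ node reward) node)
    {o : ℕ → Node} (ho : IsBranch o)
    (hopt : ∀ k, z ≤ k → ∀ s, Descendant (o k) (node s) →
      bestPayoff f - f (arm s) ≤ ν₁ * ρ ^ k)
    {w : Node} (hz : z ≤ w.1) (hw : w ≠ o w.1)
    (hgap : ∀ s, Descendant w (node s) → 2 * (ν₁ * ρ ^ w.1) ≤ bestPayoff f - f (arm s))
    {n t : ℕ} (ht1 : 1 ≤ t) (htn : t ≤ n) (hsel : Descendant w (node t))
    (hc : 0 < playCount node t w)
    (hS : 16 * Real.log n / (ν₁ * ρ ^ w.1) < regretBelow f node arm t w) :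
    (∃ k ∈ Finset.Icc z (z + t), ConfidenceFails f node arm reward (-1) t (o k)) ∨
      ConfidenceFails f node arm reward 1 t w := by
  classical
  rcases hr.exists_branch_le_or_lt ho hz hw hsel hc (bestPayoff f) with ⟨k, hk, hU⟩ | hU
  · left
    by_cases hN : 0 < playCount node t (o k)
    · refine ⟨k, Finset.mem_Icc.2 ⟨hk, ?_⟩, hN, ?_⟩
      -- Nodes played so far have depth at most `z + t`, so only `t + 1` nodes of the branch can
      -- have a finite `U`-value.
      · obtain ⟨s, hs⟩ := Finset.card_pos.1 hN
        obtain ⟨h1, h2⟩ := Finset.mem_filter.1 hs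
        have h3 := h2.fst_le
        rw [ho.fst] at h3
        have := hr.fst_le s
        have := Finset.mem_range.1 h1
        omega
      · rw [uValue_eq f arm hN, EReal.coe_le_coe_iff, ho.fst] at hU
        have hN0 : (0 : ℝ) < playCount node t (o k) := by exact_mod_cast hN
        -- The regret below an optimal node is at most its count times `ν₁ρ^k`, which the diameter
        -- term compensates; only noise and confidence width remain.
        have h1 := regretBelow_le (t := t) (hopt k hk)
        have h2 : (deviation f node arm reward t (o k) - regretBelow f node arm t (o k) +
          Real.sqrt (2 * (playCount node t (o k) : ℝ) * Real.log t) +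
            playCount node t (o k) * (ν₁ * ρ ^ k)) / playCount node t (o k) ≤ 0 := by linarith
        rw [div_le_iff₀ hN0, zero_mul] at h2
        linarith
    · rw [uValue_eq_top hN] at hU
      exact absurd hU (not_le.2 (EReal.coe_lt_top _))
  · right
    refine ⟨hc, ?_⟩
    have hN0 : (0 : ℝ) < playCount node t w := by exact_mod_cast hc
    rw [uValue_eq f arm hc, EReal.coe_lt_coe_iff] at hU
    have h1 := le_regretBelow (t := t) hgap
    have h2 : 0 < (deviation f node arm reward t w - regretBelow f node arm t w +
          Real.sqrt (2 * (playCount node t w : ℝ) * Real.log t) +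
            playCount node t w * (ν₁ * ρ ^ w.1)) / playCount node t w := by linarith
    have h3 := (div_pos_iff_of_pos_right hN0).1 h2
    set N : ℝ := (playCount node t w : ℝ)
    set S := regretBelow f node arm t w
    have hα : 0 < ν₁ * ρ ^ w.1 := by positivity
    set α := ν₁ * ρ ^ w.1
    have hlog : Real.log t ≤ Real.log n :=
      Real.log_le_log (by exact_mod_cast ht1) (by exact_mod_cast htn)
    have hlog0 : 0 ≤ Real.log t := Real.log_nonneg (by exact_mod_cast ht1)
    rw [div_lt_iff₀ hα] at hS
    have h4 : 2 * Real.sqrt (2 * N * Real.log t) ≤ S - N * α := by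
      have h5 : 0 ≤ S - N * α := by nlinarith
      refine abs_le_of_sq_le_sq' ?_ h5 |>.2
      rw [mul_pow, Real.sq_sqrt (by positivity)]
      have h6 : N * (8 * Real.log n) ≤ N * (S * α / 2) :=
        mul_le_mul_of_nonneg_left (by linarith) hN0.le
      have h7 : N * Real.log t ≤ N * Real.log n := by gcongr
      -- Since `S ≥ 2Nα`, this product is nonnegative. It rearranges to `(S - Nα)² ≥ NαS/2`, and `Sα
      -- > 16 ln n` makes the right side at least `8N ln n`.
      have h8 : 0 ≤ (S - 2 * (N * α)) * (2 * S - N * α) :=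
        mul_nonneg (by linarith) (by nlinarith)
      nlinarith
    linarith

/-- Each term `(t+2)/t³` is at most `2/(t-1) - 2/t`, which telescopes. The sum starts at `22`
because earlier rounds cannot exceed the regret threshold. -/
theorem sum_Ico_tail_le (n : ℕ) :
    ∑ t ∈ Finset.Ico 22 n, (((t : ℝ) + 1) * (1 / (t : ℝ) ^ 3) + 1 / (t : ℝ) ^ 3) ≤ 1 := by
  have H : ∀ m : ℕ, ∑ t ∈ Finset.Ico 22 (22 + m),
      (((t : ℝ) + 1) * (1 / (t : ℝ) ^ 3) + 1 / (t : ℝ) ^ 3) ≤ 2 / 21 - 2 / (21 + (m : ℝ)) := by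
    intro m
    induction m with
    | zero => simp
    | succ m ih =>
      rw [← add_assoc, Finset.sum_Ico_succ_top (by omega)]
      have hm : (0 : ℝ) ≤ m := Nat.cast_nonneg m
      have h1 : (((22 + m : ℕ) : ℝ) + 1) * (1 / ((22 + m : ℕ) : ℝ) ^ 3) +
          1 / ((22 + m : ℕ) : ℝ) ^ 3 ≤ 2 / (21 + (m : ℝ)) - 2 / (21 + ((m + 1 : ℕ) : ℝ)) := by
        push_cast
        rw [div_sub_div _ _ (by positivity) (by positivity), ← sub_nonneg]
        have : (2 * (21 + (m + 1 : ℝ)) - (21 + (m : ℝ)) * 2) / ((21 + (m : ℝ)) * (21 + (m + 1))) -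
          ((22 + (m : ℝ) + 1) * (1 / (22 + (m : ℝ)) ^ 3) + 1 / (22 + (m : ℝ)) ^ 3) =
            (2 * (22 + (m : ℝ)) ^ 2 - (24 + m) * (21 + m)) / ((21 + (m : ℝ)) * (22 + m) ^ 3) := by
          field_simp
          ring
        rw [this]
        refine div_nonneg ?_ (by positivity)
        nlinarith
      linarith
  have h2 : ∑ t ∈ Finset.Ico 22 n, (((t : ℝ) + 1) * (1 / (t : ℝ) ^ 3) + 1 / (t : ℝ) ^ 3) ≤
      ∑ t ∈ Finset.Ico 22 (22 + n), (((t : ℝ) + 1) * (1 / (t : ℝ) ^ 3) + 1 / (t : ℝ) ^ 3) :=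
    Finset.sum_le_sum_of_subset_of_nonneg (Finset.Ico_subset_Ico_right (by omega))
      fun t _ _ => by positivity
  have h3 := H n
  have h4 : 0 ≤ 2 / (21 + (n : ℝ)) := by positivity
  linarith

/-! ### Expected regret below a suboptimal node -/

section Run

variable {X Ω : Type*} [MeasurableSpace X] [MeasurableSpace Ω] {μ : Measure Ω}
  {M : X → Measure ℝ} {z : ℕ} {ν₁ ρ : ℝ} {P : Node → Set X}
  {node : ℕ → Ω → Node} {arm : ℕ → Ω → X} {reward : ℕ → Ω → ℝ}

theorem IsRun.isSearchRun (hrun : IsRun z ν₁ ρ P M μ node arm reward) (ω : Ω) :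
    IsSearchRun z (uValue ν₁ ρ (fun s => node s ω) (fun s => reward s ω)) (fun s => node s ω) :=
  fun t => hrun.selects t ω

theorem IsRun.measurableSet_confidenceFails (hM : IsEnvironment M)
    (hrun : IsRun z ν₁ ρ P M μ node arm reward) (ε : ℝ) (t : ℕ) (v : Node) :
    MeasurableSet {ω | ConfidenceFails (meanPayoff M) (fun s => node s ω) (fun s => arm s ω)
      (fun s => reward s ω) ε t v} := by
  have h1 : Measurable fun ω => playCount (fun s => node s ω) t v :=
    measurable_playCount (fun s _ => hrun.measurable_node s) v
  have h2 := measurable_deviation hM.measurable_meanPayoff (t := t)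
    (fun s _ => hrun.measurable_node s)
    (fun s _ => hrun.measurable_arm s) (fun s _ => hrun.measurable_reward s) v
  have h3 : Measurable fun ω => (playCount (fun s => node s ω) t v : ℝ) :=
    (Measurable.of_discrete (f := fun k : ℕ => (k : ℝ))).comp h1
  refine MeasurableSet.inter (measurableSet_lt measurable_const h1) ?_
  exact measurableSet_le ((h3.const_mul 2).mul_const _).sqrt (h2.const_mul ε)

/-- The expected regret accumulated below a suboptimal node. -/
theorem IsRun.integral_regretBelow_le [IsProbabilityMeasure μ] (hM : IsEnvironment M)
    (hν₁ : 0 < ν₁) (hρ₀ : 0 < ρ) (hP : IsTreeOfCoverings P)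
    (hrun : IsRun z ν₁ ρ P M μ node arm reward)
    {o : ℕ → Node} (ho : IsBranch o)
    (hopt : ∀ k, z ≤ k → ∀ x ∈ P (o k),
      bestPayoff (meanPayoff M) - meanPayoff M x ≤ ν₁ * ρ ^ k)
    {w : Node} (hwv : w.Valid) (hz : z ≤ w.1) (hw : w ≠ o w.1)
    (hgap : ∀ x ∈ P w, 2 * (ν₁ * ρ ^ w.1) ≤ bestPayoff (meanPayoff M) - meanPayoff M x)
    {D : ℝ} (hD0 : 0 ≤ D)
    (hD : ∀ x ∈ P w, bestPayoff (meanPayoff M) - meanPayoff M x ≤ D) {n : ℕ} (hn : 2 ≤ n) :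
    ∫ ω, regretBelow (meanPayoff M) (fun s => node s ω) (fun s => arm s ω) n w ∂μ ≤
      16 * Real.log n / (ν₁ * ρ ^ w.1) + 2 * D := by
  classical
  set f := meanPayoff M with hf
  have hα : 0 < ν₁ * ρ ^ w.1 := by positivity
  set bad : ℕ → Set Ω := fun t =>
    (⋃ k ∈ Finset.Icc z (z + t), {ω | ConfidenceFails f (fun s => node s ω) (fun s => arm s ω)
      (fun s => reward s ω) (-1) t (o k)}) ∪ {ω | ConfidenceFails f (fun s => node s ω)
        (fun s => arm s ω) (fun s => reward s ω) 1 t w} with hbad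
  have hbadm : ∀ t, MeasurableSet (bad t) := fun t =>
    (Finset.measurableSet_biUnion _ fun k _ => hrun.measurableSet_confidenceFails hM _ _ _).union
      (hrun.measurableSet_confidenceFails hM _ _ _)
  have hbadμ : ∀ t, 1 ≤ t → μ.real (bad t) ≤
      ((t : ℝ) + 1) * (1 / (t : ℝ) ^ 3) + 1 / (t : ℝ) ^ 3 := by
    intro t ht
    have h1 : μ (bad t) ≤ ENNReal.ofReal (((t : ℝ) + 1) * (1 / (t : ℝ) ^ 3) + 1 / (t : ℝ) ^ 3) := by
      rw [ENNReal.ofReal_add (by positivity) (by positivity)]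
      refine (measure_union_le _ _).trans (add_le_add ?_ ?_)
      · refine (measure_biUnion_finset_le _ _).trans ?_
        refine (Finset.sum_le_sum fun k _ =>
          measure_confidence_le hM hrun (o k) (by norm_num) ht).trans ?_
        rw [Finset.sum_const, Nat.card_Icc, nsmul_eq_mul, ENNReal.ofReal_mul (by positivity)]
        gcongr
        rw [← Nat.cast_add_one, ENNReal.ofReal_natCast]
        gcongr
        omega
      · exact measure_confidence_le hM hrun w (by norm_num) ht
    exact ENNReal.toReal_le_of_le_ofReal (by positivity) h1
  have hlog2 : Real.log 2 ≤ Real.log n := Real.log_le_log (by norm_num) (by exact_mod_cast hn)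
  -- Gaps are at most `1`, so a suboptimal region has `ν₁ρ^h ≤ 1/2` and the threshold is at least
  -- `32 ln n ≥ 32 ln 2 > 22`. Exceeding it takes at least `22` rounds.
  have hlog : 22 ≤ 32 * Real.log n := by linarith [Real.log_two_gt_d9]
  have hpt : ∀ ω, ∀ m ≤ n, regretBelow f (fun s => node s ω) (fun s => arm s ω) m w ≤
      (16 * Real.log n / (ν₁ * ρ ^ w.1) + D) +
        ∑ t ∈ Finset.Ico 22 m, D * (bad t).indicator (fun _ => (1 : ℝ)) ω := by
    intro ω m hm
    have hΘ : 0 ≤ 16 * Real.log n / (ν₁ * ρ ^ w.1) := div_nonneg (by linarith) hα.le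
    have hind : ∀ t, 0 ≤ D * (bad t).indicator (fun _ => (1 : ℝ)) ω := fun t =>
      mul_nonneg hD0 (Set.indicator_nonneg (fun _ _ => zero_le_one) _)
    have hreg : ∀ v : Node, v.Valid → ∀ s, Descendant v (node s ω) → arm s ω ∈ P v :=
      fun v hv s h => hP.subset_of_descendant h hv (hrun.arm_mem s ω)
    induction m with
    | zero => simp [regretBelow]; linarith
    | succ m ih =>
      have ih := ih (by omega)
      rw [regretBelow_succ]
      have hmono : ∑ t ∈ Finset.Ico 22 m, D * (bad t).indicator (fun _ => (1 : ℝ)) ω ≤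
          ∑ t ∈ Finset.Ico 22 (m + 1), D * (bad t).indicator (fun _ => (1 : ℝ)) ω :=
        Finset.sum_le_sum_of_subset_of_nonneg (Finset.Ico_subset_Ico_right (by omega))
          fun t _ _ => hind t
      split_ifs with hsel
      · have hδ := hD _ (hreg w hwv m hsel)
        -- Below the threshold, one more round overshoots it by at most `D`. Above it, each further
        -- increment of at most `D` is paid for by a bad event.
        rcases le_or_gt (regretBelow f (fun s => node s ω) (fun s => arm s ω) m w)
          (16 * Real.log n / (ν₁ * ρ ^ w.1)) with hle | hlt
        · have := Finset.sum_nonneg fun t (_ : t ∈ Finset.Ico 22 (m + 1)) => hind t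
          linarith
        · have h1 : regretBelow f (fun s => node s ω) (fun s => arm s ω) m w ≤
              playCount (fun s => node s ω) m w * 1 :=
            regretBelow_le fun s hs => hM.gap_le_one _
          have hc : 0 < playCount (fun s => node s ω) m w := by
            have : (0 : ℝ) < playCount (fun s => node s ω) m w := by linarith
            exact_mod_cast this
          have hα2 : 2 * (ν₁ * ρ ^ w.1) ≤ 1 :=
            (hgap _ (hreg w hwv m hsel)).trans (hM.gap_le_one _)
          have h22 : 22 ≤ m := by
            have h2 : 32 * Real.log n ≤ 16 * Real.log n / (ν₁ * ρ ^ w.1) := by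
              rw [le_div_iff₀ hα]
              nlinarith
            have h3 := playCount_le (fun s => node s ω) m w
            have h4 : (playCount (fun s => node s ω) m w : ℝ) ≤ m := by exact_mod_cast h3
            have : (22 : ℝ) ≤ m := by linarith
            exact_mod_cast this
          have hb : ω ∈ bad m := by
            have h5 := (hrun.isSearchRun ω).confidenceFails (f := f) (arm := fun s => arm s ω)
              hν₁ hρ₀ ho
              (fun k hk s hs => hopt k hk _ (hreg _ (ho.valid k) s hs)) hz hw
              (fun s hs => hgap _ (hreg w hwv s hs)) (n := n) (t := m) (by omega) (by omega) hsel
              hc hlt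
            rcases h5 with ⟨k, hk, h5⟩ | h5
            · exact Or.inl (Set.mem_iUnion₂.2 ⟨k, hk, h5⟩)
            · exact Or.inr h5
          rw [Finset.sum_Ico_succ_top h22, Set.indicator_of_mem hb]
          linarith
      · linarith
  have hint : ∀ t, Integrable (fun ω => D * (bad t).indicator (fun _ => (1 : ℝ)) ω) μ := fun t =>
    ((integrable_const 1).indicator (hbadm t)).const_mul _
  have hnn : ∀ ω, 0 ≤ regretBelow f (fun s => node s ω) (fun s => arm s ω) n w := fun ω =>
    Finset.sum_nonneg fun s _ => sub_nonneg.2 (hM.le_bestPayoff _)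
  calc _ ≤ ∫ ω, ((16 * Real.log n / (ν₁ * ρ ^ w.1) + D) +
        ∑ t ∈ Finset.Ico 22 n, D * (bad t).indicator (fun _ => (1 : ℝ)) ω) ∂μ := by
        refine integral_mono_of_nonneg (Filter.Eventually.of_forall hnn) ?_
          (Filter.Eventually.of_forall fun ω => hpt ω n le_rfl)
        exact (integrable_const _).add (integrable_finsetSum _ fun t _ => hint t)
    _ = (16 * Real.log n / (ν₁ * ρ ^ w.1) + D) + ∑ t ∈ Finset.Ico 22 n, D * μ.real (bad t) := by
        rw [integral_add (integrable_const _) (integrable_finsetSum _ fun t _ => hint t),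
          integral_finsetSum _ fun t _ => hint t]
        congr 1
        · simp
        · refine Finset.sum_congr rfl fun t _ => ?_
          rw [integral_const_mul, integral_indicator_const _ (hbadm t)]
          simp
    _ ≤ (16 * Real.log n / (ν₁ * ρ ^ w.1) + D) + D * 1 := by
        rw [← Finset.mul_sum]
        gcongr
        refine (Finset.sum_le_sum fun t ht => hbadμ t ?_).trans (sum_Ico_tail_le n)
        have := (Finset.mem_Ico.1 ht).1
        omega
    _ = _ := by ring

end Run


/-! ### Geometry of the regions -/

/-- The suboptimality of the region of a node. -/
noncomputable def regionGap {X : Type*} (f : X → ℝ) (P : Node → Set X) (v : Node) : ℝ :=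
  bestPayoff f - sSup (f '' P v)

/-- The nodes of depth `h`. -/
def levelNodes (h : ℕ) : Finset Node := (Finset.Icc 1 (2 ^ h)).image (Prod.mk h)

theorem mem_levelNodes {h : ℕ} {v : Node} : v ∈ levelNodes h ↔ v.1 = h ∧ v.Valid := by
  obtain ⟨k, i⟩ := v
  simp only [levelNodes, Finset.mem_image, Finset.mem_Icc, Prod.mk.injEq, Node.Valid]
  constructor
  · rintro ⟨j, hj, rfl, rfl⟩; exact ⟨rfl, hj⟩
  · rintro ⟨rfl, hj⟩; exact ⟨i, hj, rfl, rfl⟩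

theorem card_levelNodes (h : ℕ) : (levelNodes h).card = 2 ^ h := by
  rw [levelNodes, Finset.card_image_of_injective _ (Prod.mk_right_injective h), Nat.card_Icc]
  simp

open Classical in
/-- The nodes of depth `h` whose region is nearly optimal. -/
noncomputable def goodNodes {X : Type*} (f : X → ℝ) (P : Node → Set X) (ν₁ ρ : ℝ) (h : ℕ) :
    Finset Node :=
  (levelNodes h).filter fun v => regionGap f P v ≤ 2 * (ν₁ * ρ ^ h)

theorem mem_goodNodes {X : Type*} {f : X → ℝ} {P : Node → Set X} {ν₁ ρ : ℝ} {h : ℕ} {v : Node} :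
    v ∈ goodNodes f P ν₁ ρ h ↔ (v.1 = h ∧ v.Valid) ∧ regionGap f P v ≤ 2 * (ν₁ * ρ ^ h) := by
  rw [goodNodes, Finset.mem_filter, mem_levelNodes]

section Regions

variable {X : Type*} {P : Node → Set X} {l : X → X → ℝ} {ν₁ ρ ν₂ : ℝ}

theorem Shrinking.nonempty (h : Shrinking P l ν₁ ρ ν₂) {v : Node} (hv : v.Valid) :
    (P v).Nonempty := by
  obtain ⟨c, hc, -⟩ := (h v.1).2
  exact ⟨c v.2, (hc v.2 hv.1 hv.2).1⟩

theorem Shrinking.le (h : Shrinking P l ν₁ ρ ν₂) (hν₁ : 0 < ν₁) (hρ₀ : 0 < ρ) {v : Node}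
    (hv : v.Valid) {x y : X} (hx : x ∈ P v) (hy : y ∈ P v) : l x y ≤ ν₁ * ρ ^ v.1 := by
  have h1 := (h v.1).1 v.2 hv.1 hv.2
  have h2 : ENNReal.ofReal (l x y) ≤ diam l (P v) :=
    le_iSup₂_of_le x hx (le_iSup₂_of_le y hy le_rfl)
  exact (ENNReal.ofReal_le_ofReal_iff (by positivity)).1 (h2.trans h1)

/-- The two disjoint balls of depth `1` have centres at dissimilarity at least `ν₂ρ`, inside a whole
space of diameter at most `ν₁`. This makes (A3) usable at all depths beyond `z`. -/
theorem Shrinking.ball_radius_le (h : Shrinking P l ν₁ ρ ν₂) (hl : IsDissimilarity l)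
    (hν₁ : 0 < ν₁) (hρ₀ : 0 < ρ) (hν₂ : 0 < ν₂) (h0 : P (0, 1) = Set.univ) :
    ν₂ * ρ ≤ ν₁ := by
  obtain ⟨c, -, hd⟩ := (h 1).2
  have h1 := hd 1 2 le_rfl (by norm_num) (by norm_num)
  have h2 : l (c 1) (c 2) ≤ ν₁ * ρ ^ 0 :=
    h.le (v := (0, 1)) hν₁ hρ₀ ⟨le_rfl, by norm_num⟩ (by rw [h0]; trivial) (by rw [h0]; trivial)
  have h3 : c 2 ∈ ball l (c 2) (ν₂ * ρ ^ 1) := by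
    show l _ _ < _
    rw [hl.self]; positivity
  have h4 : c 2 ∉ ball l (c 1) (ν₂ * ρ ^ 1) := fun h => Set.disjoint_left.1 h1 h h3
  have h5 : ν₂ * ρ ^ 1 ≤ l (c 1) (c 2) := not_lt.1 h4
  simpa using h5.trans h2

theorem exists_gap_lt {f : X → ℝ} {v : Node} (hne : (P v).Nonempty) {η : ℝ}
    (hη : 0 < η) : ∃ x ∈ P v, bestPayoff f - f x < regionGap f P v + η := by
  obtain ⟨_, ⟨x, hx, rfl⟩, h⟩ := exists_lt_of_lt_csSup (hne.image f)
    (show sSup (f '' P v) - η < sSup (f '' P v) by linarith)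
  exact ⟨x, hx, by unfold regionGap; linarith⟩

end Regions

/-! ### Optimal branch, gaps inside good regions, number of good nodes -/

section Environment

variable {X : Type*} [MeasurableSpace X] {M : X → Measure ℝ} {P : Node → Set X}
  {l : X → X → ℝ} {ν₁ ρ ν₂ L ε₀ : ℝ}

theorem IsEnvironment.regionGap_le (hM : IsEnvironment M) {v : Node} {x : X} (hx : x ∈ P v) :
    regionGap (meanPayoff M) P v ≤ bestPayoff (meanPayoff M) - meanPayoff M x :=
  sub_le_sub_left (le_csSup (hM.bddAbove _) (Set.mem_image_of_mem _ hx)) _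

/-- There is a branch of optimal nodes. -/
theorem IsEnvironment.exists_optimal_branch (hM : IsEnvironment M) (hP : IsTreeOfCoverings P)
    (hne : ∀ v : Node, v.Valid → (P v).Nonempty) :
    ∃ o : ℕ → Node, IsBranch o ∧ ∀ k, regionGap (meanPayoff M) P (o k) = 0 := by
  classical
  set g := regionGap (meanPayoff M) P with hg
  -- The supremum over a region is the larger of the suprema over its children, so a zero gap passes
  -- to a child. No arm needs to attain `f*`.
  have hstep : ∀ v : Node, v.Valid → g v = 0 → g v.left = 0 ∨ g v.right = 0 := by
    intro v hv h0
    have h1 : P v = P v.left ∪ P v.right := hP.split v.1 v.2 hv.1 hv.2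
    have h2 : sSup (meanPayoff M '' P v) =
        max (sSup (meanPayoff M '' P v.left)) (sSup (meanPayoff M '' P v.right)) := by
      rw [h1, Set.image_union, csSup_union (hM.bddAbove _) ((hne _ hv.left).image _)
        (hM.bddAbove _) ((hne _ hv.right).image _)]
    simp only [hg, regionGap] at h0 ⊢
    rw [h2] at h0
    rcases max_choice (sSup (meanPayoff M '' P v.left)) (sSup (meanPayoff M '' P v.right)) with
      h | h
    · left; rw [h] at h0; exact h0
    · right; rw [h] at h0; exact h0
  let S := {v : Node // v.Valid ∧ g v = 0}
  have hroot : g (0, 1) = 0 := by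
    simp only [hg, regionGap, hP.root, Set.image_univ]
    exact sub_self _
  let next : S → S := fun v =>
    if h : g v.1.left = 0 then ⟨v.1.left, v.2.1.left, h⟩
    else ⟨v.1.right, v.2.1.right, (hstep v.1 v.2.1 v.2.2).resolve_left h⟩
  have hnext : ∀ v : S, (next v).1 = v.1.left ∨ (next v).1 = v.1.right := by
    intro v
    by_cases h : g v.1.left = 0
    · left; simp [next, h]
    · right; simp [next, h]
  let o : ℕ → S := fun k => next^[k] ⟨(0, 1), ⟨le_rfl, by norm_num⟩, hroot⟩
  have hsucc : ∀ k, o (k + 1) = next (o k) := fun k => Function.iterate_succ_apply' _ _ _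
  refine ⟨fun k => (o k).1, ⟨?_, fun k => (o k).2.1, fun k => ?_⟩, fun k => (o k).2.2⟩
  · intro k
    induction k with
    | zero => rfl
    | succ k ih =>
      rcases hnext (o k) with h | h
      · rw [hsucc, h, Node.left_fst, ih]
      · rw [hsucc, h, Node.right_fst, ih]
  · rw [hsucc]; exact hnext (o k)

/-- All the arms of an optimal region are nearly optimal. -/
theorem LocallyWeaklyLipschitz.gap_le_of_regionGap_eq_zero (hM : IsEnvironment M)
    (hA1 : Shrinking P l ν₁ ρ ν₂) (hA2 : LocallyWeaklyLipschitz (meanPayoff M) l ε₀ L)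
    (hν₁ : 0 < ν₁) (hρ₀ : 0 < ρ) {v : Node} (hv : v.Valid) (hε : ν₁ * ρ ^ v.1 ≤ ε₀)
    (h0 : regionGap (meanPayoff M) P v = 0) {x : X} (hx : x ∈ P v) :
    bestPayoff (meanPayoff M) - meanPayoff M x ≤ ν₁ * ρ ^ v.1 := by
  have hd := (hA1 v.1).1 v.2 hv.1 hv.2
  have h1 := hA2.optimal (P v) ⟨x, hx⟩ (sub_eq_zero.1 h0).symm
    (hd.trans (ENNReal.ofReal_le_ofReal hε))
  have h2 := (ENNReal.ofReal_le_ofReal_iff (by positivity)).1 (h1.trans hd)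
  have h3 := csInf_le (hM.bddBelow (P v)) (Set.mem_image_of_mem _ hx)
  linarith

/-- All the arms of a nearly optimal region are nearly optimal. -/
theorem LocallyWeaklyLipschitz.gap_le_max (hM : IsEnvironment M)
    (hA1 : Shrinking P l ν₁ ρ ν₂) (hA2 : LocallyWeaklyLipschitz (meanPayoff M) l ε₀ L)
    (hL : 0 < L) (hν₁ : 0 < ν₁) (hρ₀ : 0 < ρ) {v : Node} (hv : v.Valid)
    (hε : 2 * (ν₁ * ρ ^ v.1) < ε₀)
    (hg : regionGap (meanPayoff M) P v ≤ 2 * (ν₁ * ρ ^ v.1)) {y : X} (hy : y ∈ P v) :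
    bestPayoff (meanPayoff M) - meanPayoff M y ≤
      L * max (2 * regionGap (meanPayoff M) P v)
        (regionGap (meanPayoff M) P v + ν₁ * ρ ^ v.1) := by
  set β := ν₁ * ρ ^ v.1 with hβ
  have hβ0 : 0 < β := by positivity
  set g := regionGap (meanPayoff M) P v with hgdef
  refine le_of_forall_pos_le_add fun e he => ?_
  -- The supremum over the region need not be attained. The slack `ε₀ - 2β > 0` keeps an arm that is
  -- optimal in the region up to `η` within `ε₀` of `f*`.
  obtain ⟨η, hη, hη1, hη2⟩ : ∃ η, 0 < η ∧ η ≤ ε₀ - 2 * β ∧ L * (2 * η) ≤ e := by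
    refine ⟨min (ε₀ - 2 * β) (e / (2 * L)), lt_min (by linarith) (by positivity),
      min_le_left _ _, ?_⟩
    calc L * (2 * min (ε₀ - 2 * β) (e / (2 * L))) ≤ L * (2 * (e / (2 * L))) := by
          gcongr; exact min_le_right _ _
      _ = e := by field_simp
  obtain ⟨x, hx, hxg⟩ := exists_gap_lt (f := meanPayoff M) (hA1.nonempty hv) hη
  set δ := bestPayoff (meanPayoff M) - meanPayoff M x with hδ
  have hδ0 : 0 ≤ δ := sub_nonneg.2 (hM.le_bestPayoff x)
  have hxy : l x y ≤ β := hA1.le hν₁ hρ₀ hv hx hy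
  have hr : β - δ + η ≤ max 0 (β - δ + η) := le_max_right _ _
  -- The ball around `x` must contain `y`, which needs radius greater than `β`. When `δ` already
  -- exceeds `β + η`, the added radius is cut off at `0`, and this produces the maximum in the
  -- bound.
  have hmem := hA2.near x (show bestPayoff (meanPayoff M) - ε₀ ≤ meanPayoff M x by linarith)
    (max 0 (β - δ + η)) (le_max_left _ _) (max_le (by linarith) (by linarith))
    (show l x y < δ + max 0 (β - δ + η) by linarith)
  have h1 : bestPayoff (meanPayoff M) - L * (2 * δ + max 0 (β - δ + η)) ≤ meanPayoff M y := hmem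
  have h2 : 2 * δ + max 0 (β - δ + η) ≤ max (2 * g) (g + β) + 2 * η := by
    rw [← max_add_add_left]
    refine max_le ?_ ?_
    · have := le_max_left (2 * g) (g + β); linarith
    · have := le_max_right (2 * g) (g + β); linarith
  have h3 := mul_le_mul_of_nonneg_left h2 hL.le
  linarith

theorem LocallyWeaklyLipschitz.gap_le (hM : IsEnvironment M)
    (hA1 : Shrinking P l ν₁ ρ ν₂) (hA2 : LocallyWeaklyLipschitz (meanPayoff M) l ε₀ L)
    (hL : 0 < L) (hν₁ : 0 < ν₁) (hρ₀ : 0 < ρ) {v : Node} (hv : v.Valid)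
    (hε : 2 * (ν₁ * ρ ^ v.1) < ε₀)
    (hg : regionGap (meanPayoff M) P v ≤ 2 * (ν₁ * ρ ^ v.1)) {y : X} (hy : y ∈ P v) :
    bestPayoff (meanPayoff M) - meanPayoff M y ≤ 4 * L * (ν₁ * ρ ^ v.1) := by
  refine (hA2.gap_le_max hM hA1 hL hν₁ hρ₀ hv hε hg hy).trans ?_
  have hβ0 : 0 < ν₁ * ρ ^ v.1 := by positivity
  calc _ ≤ L * (4 * (ν₁ * ρ ^ v.1)) := by gcongr; exact max_le (by linarith) (by linarith)
    _ = _ := by ring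

/-- A nearly optimal region can have a descendant region that is not nearly optimal only when `L` is
not too small. -/
theorem LocallyWeaklyLipschitz.half_le_or_lt (hM : IsEnvironment M)
    (hA1 : Shrinking P l ν₁ ρ ν₂) (hA2 : LocallyWeaklyLipschitz (meanPayoff M) l ε₀ L)
    (hL : 0 < L) (hν₁ : 0 < ν₁) (hρ₀ : 0 < ρ) {v : Node} (hv : v.Valid)
    (hε : 2 * (ν₁ * ρ ^ v.1) < ε₀)
    (hg : regionGap (meanPayoff M) P v ≤ 2 * (ν₁ * ρ ^ v.1)) {y : X} (hy : y ∈ P v)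
    (hyg : 2 * (ν₁ * ρ ^ (v.1 + 1)) < bestPayoff (meanPayoff M) - meanPayoff M y) :
    1 / 2 ≤ L ∨ ρ < L := by
  by_contra! hcon
  obtain ⟨hL1, hL2⟩ := hcon
  have h1 := hA2.gap_le_max hM hA1 hL hν₁ hρ₀ hv hε hg hy
  have h2 := hM.regionGap_le hy
  have hβ0 : 0 < ν₁ * ρ ^ v.1 := by positivity
  have h3 : ν₁ * ρ ^ (v.1 + 1) = ρ * (ν₁ * ρ ^ v.1) := by ring
  rw [h3] at hyg
  set β := ν₁ * ρ ^ v.1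
  set g := regionGap (meanPayoff M) P v
  -- As `g` is at most the gap of `y`, the upper bound feeds back into itself: the first case gives
  -- `g ≤ 2Lg < g`, the second `K(1 - L) ≤ Lβ` against `K > 2ρβ`.
  rcases max_cases (2 * g) (g + β) with ⟨h4, h5⟩ | ⟨h4, h5⟩
  · rw [h4] at h1
    nlinarith
  · rw [h4] at h1
    set K := L * (g + β) with hK
    have h6 : K * (1 - L) ≤ L * β := by nlinarith
    have h7 : 2 * (ρ * β) * (1 - L) < L * β :=
      lt_of_lt_of_le (mul_lt_mul_of_pos_right (lt_of_lt_of_le hyg h1) (by linarith)) h6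
    have h8 : ρ * β ≤ 2 * (ρ * β) * (1 - L) := by
      have : 0 < ρ * β := by positivity
      nlinarith
    have h9 : ρ * β < L * β := h8.trans_lt h7
    exact absurd (lt_of_mul_lt_mul_right h9 hβ0.le) (not_lt.2 hL2)

/-- The packing bound controls the number of nearly optimal nodes. -/
theorem PackingBound.card_goodNodes_le {C d : ℝ} (hM : IsEnvironment M) (hl : IsDissimilarity l)
    (hA1 : Shrinking P l ν₁ ρ ν₂) (hA2 : LocallyWeaklyLipschitz (meanPayoff M) l ε₀ L)
    (hA3 : PackingBound (meanPayoff M) l ε₀ (4 * L * ν₁ / ν₂) C d) (hC : 0 < C)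
    (hL : 0 < L) (hν₁ : 0 < ν₁) (hν₂ : 0 < ν₂) (hρ₀ : 0 < ρ) {h : ℕ}
    (hε : 2 * (ν₁ * ρ ^ h) < ε₀) (hε2 : ν₂ * ρ ^ h ≤ ε₀) :
    ((goodNodes (meanPayoff M) P ν₁ ρ h).card : ℝ) ≤ C * (ν₂ * ρ ^ h) ^ (-d) := by
  classical
  obtain ⟨c, hc, hdis⟩ := (hA1 h).2
  have hr : 0 < ν₂ * ρ ^ h := by positivity
  have hself : ∀ i, c i ∈ ball l (c i) (ν₂ * ρ ^ h) := fun i => by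
    show l _ _ < _
    rw [hl.self]; exact hr
  set G := goodNodes (meanPayoff M) P ν₁ ρ h with hG
  have hdisj : ∀ v ∈ G, ∀ w ∈ G, v ≠ w →
      Disjoint (ball l (c v.2) (ν₂ * ρ ^ h)) (ball l (c w.2) (ν₂ * ρ ^ h)) := by
    intro v hv w hw hvw
    obtain ⟨⟨rfl, hv1, hv2⟩, -⟩ := mem_goodNodes.1 hv
    obtain ⟨⟨hw0, hw1, hw2⟩, -⟩ := mem_goodNodes.1 hw
    rw [hw0] at hw2
    rcases lt_trichotomy v.2 w.2 with h | h | h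
    · exact hdis _ _ hv1 h hw2
    · exact absurd (Prod.ext hw0.symm h) hvw
    · exact (hdis _ _ hw1 h hv2).symm
  have hinj : Set.InjOn (fun v : Node => c v.2) G := by
    intro v hv w hw hvw
    by_contra hne
    refine Set.disjoint_left.1 (hdisj v hv w hw hne) (hself v.2) ?_
    simp only at hvw
    rw [hvw]; exact hself w.2
  have hcard : ((G.image fun v : Node => c v.2).card : ℕ∞) ≤
      packingNumber l (nearOptimal (meanPayoff M) (4 * L * ν₁ / ν₂ * (ν₂ * ρ ^ h)))
        (ν₂ * ρ ^ h) := by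
    refine le_iSup₂_of_le (G.image fun v : Node => c v.2) ⟨?_, ?_⟩ le_rfl
    · intro x hx y hy
      obtain ⟨v, hv, rfl⟩ := Finset.mem_image.1 hx
      obtain ⟨⟨rfl, hv1⟩, hv2⟩ := mem_goodNodes.1 hv
      have h1 := hA2.gap_le hM hA1 hL hν₁ hρ₀ hv1 hε hv2 ((hc v.2 hv1.1 hv1.2).2 hy)
      have h2 : 4 * L * ν₁ / ν₂ * (ν₂ * ρ ^ v.1) = 4 * L * (ν₁ * ρ ^ v.1) := by field_simp
      rw [h2]
      show bestPayoff (meanPayoff M) - _ ≤ meanPayoff M y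
      linarith
    · rw [Finset.coe_image]
      rintro _ ⟨v, hv, rfl⟩ _ ⟨w, hw, rfl⟩ hvw
      exact hdisj v hv w hw fun h => hvw (by rw [h])
  rw [Finset.card_image_of_injOn hinj] at hcard
  have h3 := hA3 _ hr hε2
  have h4 : ((G.card : ℕ) : ENNReal) ≤ ENNReal.ofReal (C * (ν₂ * ρ ^ h) ^ (-d)) := by
    refine le_trans ?_ h3
    exact_mod_cast hcard
  have h5 := ENNReal.toReal_le_of_le_ofReal (by positivity) h4
  simpa using h5

end Environment


/-! ### Decomposition of the regret -/

/-- The children of the nearly optimal nodes of depth `h` that are not nearly optimal. -/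
noncomputable def badChildren {X : Type*} (f : X → ℝ) (P : Node → Set X) (ν₁ ρ : ℝ) (h : ℕ) :
    Finset Node :=
  ((goodNodes f P ν₁ ρ h).image Node.left ∪ (goodNodes f P ν₁ ρ h).image Node.right) \
    goodNodes f P ν₁ ρ (h + 1)

theorem card_badChildren_le {X : Type*} (f : X → ℝ) (P : Node → Set X) (ν₁ ρ : ℝ) (h : ℕ) :
    (badChildren f P ν₁ ρ h).card ≤ 2 * (goodNodes f P ν₁ ρ h).card := by
  refine (Finset.card_le_card Finset.sdiff_subset).trans ((Finset.card_union_le _ _).trans ?_)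
  have h1 := Finset.card_image_le (s := goodNodes f P ν₁ ρ h) (f := Node.left)
  have h2 := Finset.card_image_le (s := goodNodes f P ν₁ ρ h) (f := Node.right)
  omega

theorem mem_badChildren {X : Type*} {f : X → ℝ} {P : Node → Set X} {ν₁ ρ : ℝ} {h : ℕ} {w : Node} :
    w ∈ badChildren f P ν₁ ρ h ↔ w.1 = h + 1 ∧ w.Valid ∧ w.parent ∈ goodNodes f P ν₁ ρ h ∧
      ¬ regionGap f P w ≤ 2 * (ν₁ * ρ ^ w.1) := by
  rw [badChildren, Finset.mem_sdiff, Finset.mem_union, Finset.mem_image, Finset.mem_image]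
  constructor
  · rintro ⟨h1, h2⟩
    have h3 : w.1 = h + 1 ∧ w.Valid ∧ w.parent ∈ goodNodes f P ν₁ ρ h := by
      rcases h1 with ⟨v, hv, rfl⟩ | ⟨v, hv, rfl⟩
      · have h4 := (mem_goodNodes.1 hv).1
        exact ⟨by rw [Node.left_fst, h4.1], h4.2.left, by rwa [Node.parent_left]⟩
      · have h4 := (mem_goodNodes.1 hv).1
        exact ⟨by rw [Node.right_fst, h4.1], h4.2.right, by rwa [Node.parent_right]⟩
    refine ⟨h3.1, h3.2.1, h3.2.2, fun h4 => h2 (mem_goodNodes.2 ⟨⟨h3.1, h3.2.1⟩, ?_⟩)⟩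
    rwa [h3.1] at h4
  · rintro ⟨h1, h2, h3, h4⟩
    refine ⟨?_, fun h5 => h4 ?_⟩
    · rcases Node.eq_left_or_right_parent (v := w) (by omega) with h5 | h5
      · exact Or.inl ⟨_, h3, h5.symm⟩
      · exact Or.inr ⟨_, h3, h5.symm⟩
    · rw [h1]; exact (mem_goodNodes.1 h5).2

theorem regret_nonneg {X Ω : Type*} [MeasurableSpace X] {M : X → Measure ℝ}
    (hM : IsEnvironment M) (arm : ℕ → Ω → X) (n : ℕ) (ω : Ω) :
    0 ≤ regret (meanPayoff M) arm n ω := by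
  have h : ∑ t ∈ Finset.range n, meanPayoff M (arm t ω) ≤
      ∑ _t ∈ Finset.range n, bestPayoff (meanPayoff M) :=
    Finset.sum_le_sum fun t _ => hM.le_bestPayoff _
  rw [Finset.sum_const, Finset.card_range, nsmul_eq_mul] at h
  exact sub_nonneg.2 h

open Classical in
theorem regretBelow_eq_sum_ite {X : Type*} (f : X → ℝ) (node : ℕ → Node) (arm : ℕ → X) (t : ℕ)
    (v : Node) : regretBelow f node arm t v = ∑ s ∈ Finset.range t,
      if Descendant v (node s) then bestPayoff f - f (arm s) else 0 :=
  Finset.sum_filter _ _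

section Run

variable {X Ω : Type*} [MeasurableSpace X] [MeasurableSpace Ω] {μ : Measure Ω}
  {M : X → Measure ℝ} {z : ℕ} {ν₁ ρ ν₂ L ε₀ : ℝ} {P : Node → Set X} {l : X → X → ℝ}
  {node : ℕ → Ω → Node} {arm : ℕ → Ω → X} {reward : ℕ → Ω → ℝ}

/-- The regret of a round is charged to a suboptimal region, to a nearly optimal node played for the
first time, or to a deep nearly optimal region. -/
theorem IsRun.regret_le (hM : IsEnvironment M) (hν₁ : 0 < ν₁) (hρ₀ : 0 < ρ) (hρ₁ : ρ < 1)
    (hL : 0 < L) (hP : IsTreeOfCoverings P) (hA1 : Shrinking P l ν₁ ρ ν₂)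
    (hA2 : LocallyWeaklyLipschitz (meanPayoff M) l ε₀ L) (hε : 2 * (ν₁ * ρ ^ z) < ε₀)
    (hrun : IsRun z ν₁ ρ P M μ node arm reward) {H : ℕ} (hH : z ≤ H) (n : ℕ) (ω : Ω) :
    regret (meanPayoff M) arm n ω ≤ n * (4 * L * (ν₁ * ρ ^ H)) +
      ∑ h ∈ Finset.Ico z H, (goodNodes (meanPayoff M) P ν₁ ρ h).card * (4 * L * (ν₁ * ρ ^ h)) +
      ∑ w ∈ levelNodes z \ goodNodes (meanPayoff M) P ν₁ ρ z,
        regretBelow (meanPayoff M) (fun s => node s ω) (fun s => arm s ω) n w +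
      ∑ h ∈ Finset.Ico z H, ∑ w ∈ badChildren (meanPayoff M) P ν₁ ρ h,
        regretBelow (meanPayoff M) (fun s => node s ω) (fun s => arm s ω) n w := by
  classical
  set f := meanPayoff M with hf
  have hr := hrun.isSearchRun ω
  have hεh : ∀ h, z ≤ h → 2 * (ν₁ * ρ ^ h) < ε₀ := fun h hh => by
    have : ρ ^ h ≤ ρ ^ z := pow_le_pow_of_le_one hρ₀.le hρ₁.le hh
    have : ν₁ * ρ ^ h ≤ ν₁ * ρ ^ z := by gcongr
    linarith
  have hc0 : ∀ h, 0 ≤ 4 * L * (ν₁ * ρ ^ h) := fun h => by positivity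
  have hδ0 : ∀ t, 0 ≤ bestPayoff f - f (arm t ω) := fun t => sub_nonneg.2 (hM.le_bestPayoff _)
  set A : ℕ → ℝ := fun t => ∑ h ∈ Finset.Ico z H, ∑ v ∈ goodNodes f P ν₁ ρ h,
    if node t ω = v then 4 * L * (ν₁ * ρ ^ h) else 0 with hA
  set B : ℕ → ℝ := fun t => ∑ w ∈ levelNodes z \ goodNodes f P ν₁ ρ z,
    if Descendant w (node t ω) then bestPayoff f - f (arm t ω) else 0 with hB
  set E : ℕ → ℝ := fun t => ∑ h ∈ Finset.Ico z H, ∑ w ∈ badChildren f P ν₁ ρ h,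
    if Descendant w (node t ω) then bestPayoff f - f (arm t ω) else 0 with hE
  have hA0 : ∀ t, 0 ≤ A t := fun t => Finset.sum_nonneg fun h _ => Finset.sum_nonneg fun v _ => by
    split_ifs; exacts [hc0 h, le_rfl]
  have hB0 : ∀ t, 0 ≤ B t := fun t => Finset.sum_nonneg fun w _ => by
    split_ifs; exacts [hδ0 t, le_rfl]
  have hE0 : ∀ t, 0 ≤ E t := fun t => Finset.sum_nonneg fun h _ => Finset.sum_nonneg fun v _ => by
    split_ifs; exacts [hδ0 t, le_rfl]
  have hround : ∀ t, bestPayoff f - f (arm t ω) ≤ 4 * L * (ν₁ * ρ ^ H) + A t + B t + E t := by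
    intro t
    rcases exists_first_failure (fun v => regionGap f P v ≤ 2 * (ν₁ * ρ ^ v.1)) hH (node t ω)
      (hr.valid t) (hr.le_fst t) with ⟨w, hwv, hd, hQ, hzw, hwH, hpar⟩ | ⟨hlt, hQ⟩ |
        ⟨w, hwv, hd, hwH, hQ⟩
    · rcases hpar with hwz | ⟨hzp, hQp⟩
      · have hmem : w ∈ levelNodes z \ goodNodes f P ν₁ ρ z := by
          refine Finset.mem_sdiff.2 ⟨mem_levelNodes.2 ⟨hwz, hwv⟩, fun h => hQ ?_⟩
          rw [hwz]; exact (mem_goodNodes.1 h).2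
        have h1 : (if Descendant w (node t ω) then bestPayoff f - f (arm t ω) else 0) ≤ B t :=
          Finset.single_le_sum (f := fun w => if Descendant w (node t ω) then
            bestPayoff f - f (arm t ω) else 0) (fun w _ => by
              split_ifs; exacts [hδ0 t, le_rfl]) hmem
        rw [if_pos hd] at h1
        linarith [hA0 t, hE0 t, hc0 H]
      -- With truncated subtraction the root is its own parent, so the alternative about the parent
      -- would contradict itself there.
      · by_cases hwz : w.1 = 0
        · exfalso
          have h0 : w.parent = w := by
            have h1 := hwv.1
            have h2 := hwv.2
            rw [hwz, pow_zero] at h2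
            refine Prod.ext ?_ ?_
            · simp only [Node.parent]; omega
            · simp only [Node.parent]; omega
          rw [h0] at hQp
          exact hQ hQp
        · have hp1 : w.1 = w.parent.1 + 1 := by simp only [Node.parent]; omega
          have hmem : w ∈ badChildren f P ν₁ ρ w.parent.1 :=
            mem_badChildren.2 ⟨hp1, hwv,
              mem_goodNodes.2 ⟨⟨rfl, hwv.parent (by omega)⟩, hQp⟩, hQ⟩
          have h1 : (if Descendant w (node t ω) then bestPayoff f - f (arm t ω) else 0) ≤
              ∑ w ∈ badChildren f P ν₁ ρ w.parent.1,
                if Descendant w (node t ω) then bestPayoff f - f (arm t ω) else 0 :=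
            Finset.single_le_sum (f := fun w => if Descendant w (node t ω) then
              bestPayoff f - f (arm t ω) else 0) (fun w _ => by
                split_ifs; exacts [hδ0 t, le_rfl]) hmem
          have h2 : (∑ w ∈ badChildren f P ν₁ ρ w.parent.1,
                if Descendant w (node t ω) then bestPayoff f - f (arm t ω) else 0) ≤ E t :=
            Finset.single_le_sum (f := fun h => ∑ w ∈ badChildren f P ν₁ ρ h,
                if Descendant w (node t ω) then bestPayoff f - f (arm t ω) else 0)
              (fun h _ => Finset.sum_nonneg fun v _ => by
                split_ifs; exacts [hδ0 t, le_rfl]) (Finset.mem_Ico.2 ⟨hzp, by omega⟩)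
          rw [if_pos hd] at h1
          linarith [hA0 t, hB0 t, hc0 H]
    · have hmem : node t ω ∈ goodNodes f P ν₁ ρ (node t ω).1 :=
        mem_goodNodes.2 ⟨⟨rfl, hr.valid t⟩, hQ⟩
      have h1 : (if node t ω = node t ω then 4 * L * (ν₁ * ρ ^ (node t ω).1) else 0) ≤
          ∑ v ∈ goodNodes f P ν₁ ρ (node t ω).1,
            if node t ω = v then 4 * L * (ν₁ * ρ ^ (node t ω).1) else 0 :=
        Finset.single_le_sum (f := fun v => if node t ω = v then
          4 * L * (ν₁ * ρ ^ (node t ω).1) else 0) (fun w _ => by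
            split_ifs; exacts [hc0 _, le_rfl]) hmem
      have h2 : (∑ v ∈ goodNodes f P ν₁ ρ (node t ω).1,
            if node t ω = v then 4 * L * (ν₁ * ρ ^ (node t ω).1) else 0) ≤ A t :=
        Finset.single_le_sum (f := fun h => ∑ v ∈ goodNodes f P ν₁ ρ h,
            if node t ω = v then 4 * L * (ν₁ * ρ ^ h) else 0)
          (fun h _ => Finset.sum_nonneg fun v _ => by
            split_ifs; exacts [hc0 _, le_rfl]) (Finset.mem_Ico.2 ⟨hr.le_fst t, hlt⟩)
      rw [if_pos rfl] at h1
      have h3 := hA2.gap_le hM hA1 hL hν₁ hρ₀ (hr.valid t) (hεh _ (hr.le_fst t)) hQ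
        (hrun.arm_mem t ω)
      linarith [hB0 t, hE0 t, hc0 H]
    · have h3 := hA2.gap_le hM hA1 hL hν₁ hρ₀ hwv (hεh _ (by omega)) hQ
        (hP.subset_of_descendant hd hwv (hrun.arm_mem t ω))
      rw [hwH] at h3
      linarith [hA0 t, hB0 t, hE0 t]
  have hsumA : ∑ t ∈ Finset.range n, A t ≤
      ∑ h ∈ Finset.Ico z H, (goodNodes f P ν₁ ρ h).card * (4 * L * (ν₁ * ρ ^ h)) := by
    rw [hA, Finset.sum_comm]
    refine Finset.sum_le_sum fun h _ => ?_
    rw [Finset.sum_comm, ← nsmul_eq_mul]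
    refine Finset.sum_le_card_nsmul _ _ _ fun v _ => ?_
    rw [← Finset.sum_filter, Finset.sum_const, nsmul_eq_mul]
    -- A selected node is outside the current tree and enters it afterwards, so a good node is
    -- charged at most once.
    have h1 : ((Finset.range n).filter fun t => node t ω = v).card ≤ 1 :=
      Finset.card_le_one.2 fun s hs t ht => hr.injective
        ((Finset.mem_filter.1 hs).2.trans (Finset.mem_filter.1 ht).2.symm)
    have h2 : (((Finset.range n).filter fun t => node t ω = v).card : ℝ) ≤ 1 := by
      exact_mod_cast h1
    exact mul_le_of_le_one_left (hc0 h) h2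
  have hsumB : ∑ t ∈ Finset.range n, B t = ∑ w ∈ levelNodes z \ goodNodes f P ν₁ ρ z,
        regretBelow f (fun s => node s ω) (fun s => arm s ω) n w := by
    rw [hB, Finset.sum_comm]
    exact Finset.sum_congr rfl fun w _ => (regretBelow_eq_sum_ite _ _ _ _ _).symm
  have hsumE : ∑ t ∈ Finset.range n, E t = ∑ h ∈ Finset.Ico z H, ∑ w ∈ badChildren f P ν₁ ρ h,
        regretBelow f (fun s => node s ω) (fun s => arm s ω) n w := by
    rw [hE, Finset.sum_comm]
    refine Finset.sum_congr rfl fun h _ => ?_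
    rw [Finset.sum_comm]
    exact Finset.sum_congr rfl fun w _ => (regretBelow_eq_sum_ite _ _ _ _ _).symm
  have hreg : regret f arm n ω = ∑ t ∈ Finset.range n, (bestPayoff f - f (arm t ω)) := by
    rw [regret, Finset.sum_sub_distrib, Finset.sum_const, Finset.card_range, nsmul_eq_mul]
  rw [hreg]
  refine (Finset.sum_le_sum fun t _ => hround t).trans ?_
  rw [Finset.sum_add_distrib, Finset.sum_add_distrib, Finset.sum_add_distrib, Finset.sum_const,
    Finset.card_range, nsmul_eq_mul, hsumB, hsumE]
  gcongr

theorem IsRun.integrable_regretBelow [IsProbabilityMeasure μ] (hM : IsEnvironment M)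
    (hrun : IsRun z ν₁ ρ P M μ node arm reward) (n : ℕ) (w : Node) :
    Integrable (fun ω => regretBelow (meanPayoff M) (fun s => node s ω) (fun s => arm s ω) n w)
      μ := by
  have hm : Measurable fun ω =>
      regretBelow (meanPayoff M) (fun s => node s ω) (fun s => arm s ω) n w :=
    -- The accumulated regret is a deviation in which every reward is replaced by the constant `f*`.
    measurable_deviation (reward := fun _ _ => bestPayoff (meanPayoff M)) hM.measurable_meanPayoff
      (fun s _ => hrun.measurable_node s) (fun s _ => hrun.measurable_arm s)
      (fun s _ => measurable_const) w
  refine Integrable.of_mem_Icc 0 n hm.aemeasurable (Filter.Eventually.of_forall fun ω => ⟨?_, ?_⟩)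
  · exact Finset.sum_nonneg fun s _ => sub_nonneg.2 (hM.le_bestPayoff _)
  · refine (regretBelow_le (D := 1) fun s _ => hM.gap_le_one _).trans ?_
    rw [mul_one]
    exact_mod_cast playCount_le _ _ _

/-- The expected regret, in terms of the numbers of nearly optimal nodes. -/
theorem IsRun.integral_regret_le [IsProbabilityMeasure μ] (hM : IsEnvironment M)
    (hν₁ : 0 < ν₁) (hρ₀ : 0 < ρ) (hρ₁ : ρ < 1)
    (hL : 0 < L) (hP : IsTreeOfCoverings P) (hA1 : Shrinking P l ν₁ ρ ν₂)
    (hA2 : LocallyWeaklyLipschitz (meanPayoff M) l ε₀ L) (hε : 2 * (ν₁ * ρ ^ z) < ε₀)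
    (hrun : IsRun z ν₁ ρ P M μ node arm reward) {H : ℕ} (hH : z ≤ H) {n : ℕ} (hn : 2 ≤ n) :
    ∫ ω, regret (meanPayoff M) arm n ω ∂μ ≤ n * (4 * L * (ν₁ * ρ ^ H)) +
      (2 ^ z - (goodNodes (meanPayoff M) P ν₁ ρ z).card) *
        (8 * Real.log n / (ν₁ ^ 2 * ρ ^ (2 * z)) + 4) +
      ∑ h ∈ Finset.Ico z H,
        ((goodNodes (meanPayoff M) P ν₁ ρ h).card * (4 * L * (ν₁ * ρ ^ h)) +
        (badChildren (meanPayoff M) P ν₁ ρ h).card *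
          (16 * Real.log n / (ν₁ * ρ ^ (h + 1)) + 8 * L * (ν₁ * ρ ^ h))) := by
  classical
  have hlog : 0 ≤ Real.log n := Real.log_natCast_nonneg n
  have hεh : ∀ h, z ≤ h → 2 * (ν₁ * ρ ^ h) < ε₀ := fun h hh => by
    have : ρ ^ h ≤ ρ ^ z := pow_le_pow_of_le_one hρ₀.le hρ₁.le hh
    have : ν₁ * ρ ^ h ≤ ν₁ * ρ ^ z := by gcongr
    linarith
  obtain ⟨o, ho, ho0⟩ := hM.exists_optimal_branch hP fun v hv => hA1.nonempty hv
  have hopt : ∀ k, z ≤ k → ∀ x ∈ P (o k),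
      bestPayoff (meanPayoff M) - meanPayoff M x ≤ ν₁ * ρ ^ k := by
    intro k hk x hx
    have h1 := hεh k hk
    have h2 : 0 < ν₁ * ρ ^ k := by positivity
    have h3 := hA2.gap_le_of_regionGap_eq_zero hM hA1 hν₁ hρ₀ (ho.valid k)
      (by rw [ho.fst]; linarith) (ho0 k) hx
    rwa [ho.fst] at h3
  have hS : ∀ w : Node, w.Valid → z ≤ w.1 →
      ¬ regionGap (meanPayoff M) P w ≤ 2 * (ν₁ * ρ ^ w.1) → ∀ D : ℝ, 0 ≤ D →
      (∀ x ∈ P w, bestPayoff (meanPayoff M) - meanPayoff M x ≤ D) →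
      ∫ ω, regretBelow (meanPayoff M) (fun s => node s ω) (fun s => arm s ω) n w ∂μ ≤
        16 * Real.log n / (ν₁ * ρ ^ w.1) + 2 * D := by
    intro w hw hz hg D hD0 hD
    refine hrun.integral_regretBelow_le hM hν₁ hρ₀ hP ho hopt hw hz ?_
      (fun x hx => (not_le.1 hg).le.trans (hM.regionGap_le hx)) hD0 hD hn
    intro hwo
    refine hg ?_
    rw [hwo, ho0]
    positivity
  have htop : ∀ w ∈ levelNodes z \ goodNodes (meanPayoff M) P ν₁ ρ z,
      ∫ ω, regretBelow (meanPayoff M) (fun s => node s ω) (fun s => arm s ω) n w ∂μ ≤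
        8 * Real.log n / (ν₁ ^ 2 * ρ ^ (2 * z)) + 4 := by
    intro w hw
    obtain ⟨h1, h2⟩ := Finset.mem_sdiff.1 hw
    obtain ⟨rfl, hv⟩ := mem_levelNodes.1 h1
    have hg : ¬ regionGap (meanPayoff M) P w ≤ 2 * (ν₁ * ρ ^ w.1) := fun h =>
      h2 (mem_goodNodes.2 ⟨⟨rfl, hv⟩, h⟩)
    refine (hS w hv le_rfl hg 1 zero_le_one fun x _ => hM.gap_le_one x).trans ?_
    obtain ⟨x, hx⟩ := hA1.nonempty hv
    have h3 := ((not_le.1 hg).le.trans (hM.regionGap_le hx)).trans (hM.gap_le_one x)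
    have h4 : 0 < ν₁ * ρ ^ w.1 := by positivity
    have h5 : ν₁ ^ 2 * ρ ^ (2 * w.1) = (ν₁ * ρ ^ w.1) ^ 2 := by ring
    rw [h5]
    -- A suboptimal region forces `2ν₁ρ^z ≤ 1`, which allows the passage to the squared denominator.
    have h6 : 16 * Real.log n / (ν₁ * ρ ^ w.1) ≤ 8 * Real.log n / (ν₁ * ρ ^ w.1) ^ 2 := by
      rw [div_le_div_iff₀ h4 (by positivity)]
      have : 0 ≤ 8 * Real.log n * (ν₁ * ρ ^ w.1) * (1 - 2 * (ν₁ * ρ ^ w.1)) :=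
        mul_nonneg (by positivity) (by linarith)
      nlinarith
    linarith
  have hchild : ∀ h ∈ Finset.Ico z H, ∀ w ∈ badChildren (meanPayoff M) P ν₁ ρ h,
      ∫ ω, regretBelow (meanPayoff M) (fun s => node s ω) (fun s => arm s ω) n w ∂μ ≤
        16 * Real.log n / (ν₁ * ρ ^ (h + 1)) + 8 * L * (ν₁ * ρ ^ h) := by
    intro h hh w hw
    have hzh := (Finset.mem_Ico.1 hh).1
    obtain ⟨h1, h2, h3, h4⟩ := mem_badChildren.1 hw
    obtain ⟨⟨h5, h6⟩, h7⟩ := mem_goodNodes.1 h3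
    have h8 := hS w h2 (by omega) h4 (4 * L * (ν₁ * ρ ^ h)) (by positivity) ?_
    · rw [h1] at h8; linarith
    · intro x hx
      have h9 := hA2.gap_le hM hA1 hL hν₁ hρ₀ h6 (hεh _ (by omega)) (by rw [h5]; exact h7)
        (hP.subset_of_descendant (Descendant.of_parent .refl (by omega)) h6 hx)
      rwa [h5] at h9
  have hint := hrun.integrable_regretBelow hM n
  have hi1 : Integrable (fun ω => ∑ w ∈ levelNodes z \ goodNodes (meanPayoff M) P ν₁ ρ z,
        regretBelow (meanPayoff M) (fun s => node s ω) (fun s => arm s ω) n w) μ :=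
    integrable_finsetSum _ fun w _ => hint w
  have hi2 : ∀ h, Integrable (fun ω => ∑ w ∈ badChildren (meanPayoff M) P ν₁ ρ h,
        regretBelow (meanPayoff M) (fun s => node s ω) (fun s => arm s ω) n w) μ := fun h =>
    integrable_finsetSum _ fun w _ => hint w
  have hi3 : Integrable (fun ω => ∑ h ∈ Finset.Ico z H, ∑ w ∈ badChildren (meanPayoff M) P ν₁ ρ h,
        regretBelow (meanPayoff M) (fun s => node s ω) (fun s => arm s ω) n w) μ :=
    integrable_finsetSum _ fun h _ => hi2 h
  refine (integral_mono_of_nonneg (Filter.Eventually.of_forall fun ω => regret_nonneg hM arm n ω)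
    (((integrable_const _).add hi1).add hi3) (Filter.Eventually.of_forall fun ω =>
      hrun.regret_le hM hν₁ hρ₀ hρ₁ hL hP hA1 hA2 hε hH n ω)).trans ?_
  rw [integral_add' ((integrable_const _).add hi1) hi3,
    integral_add' (integrable_const _) hi1, integral_const, probReal_univ, one_smul,
    integral_finsetSum _ fun w _ => hint w, integral_finsetSum _ fun h _ => hi2 h,
    Finset.sum_add_distrib]
  have h1 : ∑ w ∈ levelNodes z \ goodNodes (meanPayoff M) P ν₁ ρ z,
      ∫ ω, regretBelow (meanPayoff M) (fun s => node s ω) (fun s => arm s ω) n w ∂μ ≤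
      (2 ^ z - (goodNodes (meanPayoff M) P ν₁ ρ z).card) *
        (8 * Real.log n / (ν₁ ^ 2 * ρ ^ (2 * z)) + 4) := by
    refine (Finset.sum_le_card_nsmul _ _ _ htop).trans (le_of_eq ?_)
    have hsub : goodNodes (meanPayoff M) P ν₁ ρ z ⊆ levelNodes z := fun v hv =>
      mem_levelNodes.2 (mem_goodNodes.1 hv).1
    have h2 := Finset.card_le_card hsub
    rw [nsmul_eq_mul, Finset.card_sdiff_of_subset hsub, Nat.cast_sub h2, card_levelNodes]
    push_cast
    ring
  have h2 : ∑ h ∈ Finset.Ico z H, ∫ ω, ∑ w ∈ badChildren (meanPayoff M) P ν₁ ρ h,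
        regretBelow (meanPayoff M) (fun s => node s ω) (fun s => arm s ω) n w ∂μ ≤
      ∑ h ∈ Finset.Ico z H, ((badChildren (meanPayoff M) P ν₁ ρ h).card : ℝ) *
          (16 * Real.log n / (ν₁ * ρ ^ (h + 1)) + 8 * L * (ν₁ * ρ ^ h)) := by
    refine Finset.sum_le_sum fun h hh => ?_
    rw [integral_finsetSum _ fun w _ => hint w, ← nsmul_eq_mul]
    exact Finset.sum_le_card_nsmul _ _ _ (hchild h hh)
  linarith

end Run


/-! ### Bounds on the terms of the decomposition -/

/-- The balance between the exploration of deep regions and the cost of the upper levels. -/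
theorem balance {A G ρ d : ℝ} (hA : 0 < A) (hG : 0 < G) (hρ₀ : 0 < ρ) (hρ₁ : ρ < 1) (hd : 0 ≤ d)
    (s : ℝ) :
    A * ρ ^ s = A ^ ((d + 1) / (d + 2)) * G ^ (1 / (d + 2)) *
      ρ ^ (s - 1 / (d + 2) * ((Real.log A - Real.log G) / Real.log (1 / ρ))) ∧
    G * ((1 / ρ) ^ (d + 1)) ^ s = A ^ ((d + 1) / (d + 2)) * G ^ (1 / (d + 2)) *
      ρ ^ ((d + 1) * (1 / (d + 2) * ((Real.log A - Real.log G) / Real.log (1 / ρ)) - s)) := by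
  have hlog : Real.log ρ < 0 := Real.log_neg hρ₀ hρ₁
  have hlog' := hlog.ne
  have hd2 : d + 2 ≠ 0 := by positivity
  have h1 : Real.log (1 / ρ) = -Real.log ρ := by rw [one_div, Real.log_inv]
  have hinv : 0 < 1 / ρ := by positivity
  -- Both identities are linear after taking logarithms. They say that `Aρ^s` and `Gρ^{-(d+1)s}`
  -- meet at the depth subtracted in the exponent, and give their common value there.
  constructor
  · refine Real.log_injOn_pos (Set.mem_Ioi.2 (by positivity)) (Set.mem_Ioi.2 (by positivity)) ?_
    rw [Real.log_mul (by positivity) (by positivity), Real.log_mul (by positivity) (by positivity),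
      Real.log_mul (by positivity) (by positivity), Real.log_rpow hρ₀, Real.log_rpow hρ₀,
      Real.log_rpow hA, Real.log_rpow hG, h1]
    field_simp
    ring
  · refine Real.log_injOn_pos (Set.mem_Ioi.2 (by positivity)) (Set.mem_Ioi.2 (by positivity)) ?_
    rw [Real.log_mul (by positivity) (by positivity), Real.log_mul (by positivity) (by positivity),
      Real.log_mul (by positivity) (by positivity), Real.log_rpow (by positivity),
      Real.log_rpow hinv, Real.log_rpow hρ₀,
      Real.log_rpow hA, Real.log_rpow hG, h1]
    field_simp
    ring

theorem sum_Ico_pow_le {r : ℝ} (hr : 1 < r) (m n : ℕ) :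
    ∑ h ∈ Finset.Ico m n, r ^ h ≤ r ^ n / (r - 1) := by
  rcases le_total m n with h | h
  · rw [geom_sum_Ico hr.ne' h]
    have : 0 < r - 1 := by linarith
    gcongr
    linarith [pow_pos (zero_lt_one.trans hr) m]
  · rw [Finset.Ico_eq_empty_of_le h, Finset.sum_empty]
    have : 0 < r - 1 := by linarith
    positivity

/-- The cost of the nearly optimal nodes of the initial depth when their number is not controlled by
the packing bound. -/
theorem initial_level_cost_le {ρ a L lam q : ℝ} {z : ℕ} (hρ₀ : 0 < ρ) (hρ : ρ ≤ 1 / 2)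
    (ha : 0 < a) (hL : ρ ≤ L) (hlam : 69 / 100 ≤ lam) (hq1 : 1 ≤ q) (hq : q ≤ 2 ^ z) :
    q * (20 * L * a + 32 * lam / (a * ρ)) ≤ (q - 1) * (8 * lam / a ^ 2) +
      lam * (64 * L / (a * ρ ^ 4) + 36 * L * a / ρ ^ (2 * z + 2)) := by
  have hL0 : 0 < L := hρ₀.trans_le hL
  have hlam0 : 0 < lam := by linarith
  have hpow : ∀ k : ℕ, (2 : ℝ) ^ k ≤ 1 / ρ ^ k := fun k => by
    rw [← one_div_pow]
    gcongr
    rw [le_div_iff₀ hρ₀]; linarith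
  -- If `q ≤ 2/ρ²`, the bound `ρ ≤ L` lets the last two terms absorb everything. Otherwise `q > 8`,
  -- so `z ≥ 4`, and the spare term `8(q - 1)` is at least `7q`.
  rcases le_or_gt q (2 / ρ ^ 2) with hcase | hcase
  · have h1 : q * (32 * lam / (a * ρ)) ≤ lam * (64 * L / (a * ρ ^ 4)) := by
      calc q * (32 * lam / (a * ρ)) ≤ 2 / ρ ^ 2 * (32 * lam / (a * ρ)) := by gcongr
        _ = lam * (64 * ρ / (a * ρ ^ 4)) := by field_simp; ring
        _ ≤ _ := by gcongr
    have h2 : q * (20 * L * a) ≤ lam * (36 * L * a / ρ ^ (2 * z + 2)) := by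
      have h3 : 4 * q ≤ 1 / ρ ^ (2 * z + 2) := by
        refine le_trans ?_ (hpow _)
        have : (1 : ℝ) ≤ 2 ^ z := one_le_pow₀ (by norm_num)
        rw [pow_add, pow_mul', sq]
        nlinarith
      calc q * (20 * L * a) ≤ 69 / 100 * (36 * L * a * (4 * q)) := by
            have : 0 < L * a * q := by positivity
            nlinarith
        _ ≤ lam * (36 * L * a * (1 / ρ ^ (2 * z + 2))) := by gcongr
        _ = _ := by ring
    have h4 : 0 ≤ (q - 1) * (8 * lam / a ^ 2) := mul_nonneg (by linarith) (by positivity)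
    linarith
  · have hq8 : 8 < q := by
      refine lt_of_le_of_lt ?_ hcase
      rw [le_div_iff₀ (by positivity)]
      nlinarith
    have hz : 4 ≤ z := by
      by_contra! h
      have h1 : (2 : ℝ) ^ z ≤ 2 ^ 3 := pow_le_pow_right₀ (by norm_num) (by omega)
      norm_num at h1
      linarith
    have hW : 4 * q / ρ ^ 4 ≤ 1 / ρ ^ (2 * z + 2) := by
      have h1 : 4 * q ≤ 1 / ρ ^ (2 * z - 2) := by
        refine le_trans ?_ (hpow _)
        rw [show 2 * z - 2 = (z - 2) + z by omega, pow_add]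
        have : (4 : ℝ) ≤ 2 ^ (z - 2) := by
          calc (4 : ℝ) = 2 ^ 2 := by norm_num
            _ ≤ _ := pow_le_pow_right₀ (by norm_num) (by omega)
        gcongr
      rw [show 2 * z + 2 = (2 * z - 2) + 4 by omega, pow_add, ← div_div]
      gcongr
    have h1 : q * (20 * L * a) ≤ lam * (9 / 2 * L * a / ρ ^ (2 * z + 2)) := by
      have h2 : 16 * (4 * q) ≤ 1 / ρ ^ (2 * z + 2) := by
        refine le_trans ?_ hW
        rw [le_div_iff₀ (by positivity)]
        have h3 : ρ ^ 4 ≤ (1 / 2) ^ 4 := by gcongr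
        nlinarith
      calc q * (20 * L * a) ≤ 69 / 100 * (9 / 2 * L * a * (16 * (4 * q))) := by
            have : 0 < L * a * q := by positivity
            nlinarith
        _ ≤ lam * (9 / 2 * L * a * (1 / ρ ^ (2 * z + 2))) := by gcongr
        _ = _ := by ring
    have h2 : lam * (126 * a * q / ρ ^ 3) ≤ lam * (63 / 2 * L * a / ρ ^ (2 * z + 2)) := by
      calc lam * (126 * a * q / ρ ^ 3) = lam * (63 / 2 * ρ * a * (4 * q / ρ ^ 4)) := by
            field_simp; ring
        _ ≤ lam * (63 / 2 * L * a * (1 / ρ ^ (2 * z + 2))) := by gcongr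
        _ = _ := by ring
    have h3 : q * (7 * lam / a ^ 2) ≤ (q - 1) * (8 * lam / a ^ 2) := by
      have : 0 < lam / a ^ 2 := by positivity
      rw [mul_div_assoc, mul_div_assoc]
      nlinarith
    have h4 : q * (32 * lam / (a * ρ)) ≤ lam * (126 * a * q / ρ ^ 3) + q * (7 * lam / a ^ 2) := by
      have h5 : lam * (126 * a * q / ρ ^ 3) + q * (7 * lam / a ^ 2) - q * (32 * lam / (a * ρ)) =
          lam * q / a ^ 2 * (126 * (a / ρ) ^ 3 + 7 - 32 * (a / ρ)) := by
        field_simp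
      have hs : 0 < a / ρ := by positivity
      -- The cubic is nearly minimal at `s = a/ρ ≈ 0.291`, and `(s - 0.291)²(s + 0.582)` has no
      -- quadratic term.
      have h6 : 0 ≤ 126 * (a / ρ) ^ 3 + 7 - 32 * (a / ρ) := by
        have := mul_nonneg (sq_nonneg (a / ρ - 291 / 1000))
          (show 0 ≤ a / ρ + 582 / 1000 by positivity)
        nlinarith
      have h7 : 0 ≤ lam * q / a ^ 2 * (126 * (a / ρ) ^ 3 + 7 - 32 * (a / ρ)) :=
        mul_nonneg (by positivity) h6
      linarith
    have h5 : 0 ≤ 64 * L / (a * ρ ^ 4) := by positivity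
    have h6 : 36 * L * a / ρ ^ (2 * z + 2) =
        9 / 2 * L * a / ρ ^ (2 * z + 2) + 63 / 2 * L * a / ρ ^ (2 * z + 2) := by ring
    rw [h6]
    nlinarith

/-! ### Cost of one depth under the packing bound -/

section Levels

variable {X : Type*} [MeasurableSpace X] {M : X → Measure ℝ} {P : Node → Set X}
  {l : X → X → ℝ} {ν₁ ρ ν₂ L ε₀ C d : ℝ}

theorem IsEnvironment.one_le_card_goodNodes (hM : IsEnvironment M) (hν₁ : 0 < ν₁) (hρ₀ : 0 < ρ)
    (hP : IsTreeOfCoverings P) (hA1 : Shrinking P l ν₁ ρ ν₂) (h : ℕ) :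
    1 ≤ (goodNodes (meanPayoff M) P ν₁ ρ h).card := by
  obtain ⟨o, ho, ho0⟩ := hM.exists_optimal_branch hP fun v hv => hA1.nonempty hv
  refine Finset.card_pos.2 ⟨o h, mem_goodNodes.2 ⟨⟨ho.fst h, ho.valid h⟩, ?_⟩⟩
  rw [ho0]; positivity

/-- The exploration cost of bad children has no factor `L`, whereas `γ` has one. This lower bound on
`L` introduces it. -/
theorem LocallyWeaklyLipschitz.half_le_or_lt_of_nonempty (hM : IsEnvironment M)
    (hP : IsTreeOfCoverings P)
    (hA1 : Shrinking P l ν₁ ρ ν₂) (hA2 : LocallyWeaklyLipschitz (meanPayoff M) l ε₀ L)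
    (hL : 0 < L) (hν₁ : 0 < ν₁) (hρ₀ : 0 < ρ) {h : ℕ} (hε : 2 * (ν₁ * ρ ^ h) < ε₀)
    (hne : (badChildren (meanPayoff M) P ν₁ ρ h).Nonempty) : 1 / 2 ≤ L ∨ ρ < L := by
  obtain ⟨w, hw⟩ := hne
  obtain ⟨h1, h2, h3, h4⟩ := mem_badChildren.1 hw
  obtain ⟨⟨h5, h6⟩, h7⟩ := mem_goodNodes.1 h3
  obtain ⟨y, hy⟩ := hA1.nonempty h2
  have hy' := hP.subset_of_descendant (Descendant.of_parent .refl (by omega)) h6 hy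
  refine hA2.half_le_or_lt hM hA1 hL hν₁ hρ₀ h6 (by rwa [h5]) (by rwa [h5]) hy' ?_
  have h8 := hM.regionGap_le hy
  rw [h1] at h4
  rw [h5]
  linarith

/-- The cost of a level whose nearly optimal nodes are controlled by the packing bound. -/
theorem level_cost_le (hM : IsEnvironment M) (hl : IsDissimilarity l) (hP : IsTreeOfCoverings P)
    (hA1 : Shrinking P l ν₁ ρ ν₂) (hA2 : LocallyWeaklyLipschitz (meanPayoff M) l ε₀ L)
    (hA3 : PackingBound (meanPayoff M) l ε₀ (4 * L * ν₁ / ν₂) C d) (hC : 0 < C)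
    (hL : 0 < L) (hν₁ : 0 < ν₁) (hν₂ : 0 < ν₂) (hρ₀ : 0 < ρ) (hρ₁ : ρ < 1) {h : ℕ}
    (hε : 2 * (ν₁ * ρ ^ h) < ε₀) (hε2 : ν₂ * ρ ^ h ≤ ε₀) {lam : ℝ} (hlam : 69 / 100 ≤ lam) :
    (goodNodes (meanPayoff M) P ν₁ ρ h).card * (4 * L * (ν₁ * ρ ^ h)) +
        (badChildren (meanPayoff M) P ν₁ ρ h).card *
          (16 * lam / (ν₁ * ρ ^ (h + 1)) + 8 * L * (ν₁ * ρ ^ h)) ≤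
      4 * C * L * ν₁ * ν₂ ^ (-d) * (16 / (ν₁ ^ 2 * ρ ^ 2) + 9) * lam *
        ((1 / ρ) ^ (d + 1)) ^ h := by
  have hlam0 : 0 < lam := by linarith
  set N : ℝ := ((goodNodes (meanPayoff M) P ν₁ ρ h).card : ℝ) with hN
  have hN0 : 0 ≤ N := Nat.cast_nonneg _
  have h1 : ((badChildren (meanPayoff M) P ν₁ ρ h).card : ℝ) *
      (16 * lam / (ν₁ * ρ ^ (h + 1)) + 8 * L * (ν₁ * ρ ^ h)) ≤
      2 * N * (32 * L * lam / (ν₁ * ρ ^ (h + 2)) + 8 * L * (ν₁ * ρ ^ h)) := by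
    rcases (badChildren (meanPayoff M) P ν₁ ρ h).eq_empty_or_nonempty with he | hne
    · rw [he, Finset.card_empty, Nat.cast_zero, zero_mul]
      positivity
    · have h2 : ρ ≤ 2 * L := by
        rcases hA2.half_le_or_lt_of_nonempty hM hP hA1 hL hν₁ hρ₀ hε hne with h | h <;> linarith
      have h3 : ((badChildren (meanPayoff M) P ν₁ ρ h).card : ℝ) ≤ 2 * N := by
        rw [hN]
        exact_mod_cast card_badChildren_le (meanPayoff M) P ν₁ ρ h
      have h4 : 16 * lam / (ν₁ * ρ ^ (h + 1)) ≤ 32 * L * lam / (ν₁ * ρ ^ (h + 2)) := by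
        calc 16 * lam / (ν₁ * ρ ^ (h + 1)) = 16 * lam * ρ / (ν₁ * ρ ^ (h + 2)) := by
              rw [pow_succ ρ (h + 1), ← mul_assoc, mul_div_mul_right _ _ hρ₀.ne']
          _ ≤ 16 * lam * (2 * L) / (ν₁ * ρ ^ (h + 2)) := by gcongr
          _ = _ := by ring
      gcongr
  have h2 : N ≤ C * (ν₂ * ρ ^ h) ^ (-d) :=
    hA3.card_goodNodes_le hM hl hA1 hA2 hC hL hν₁ hν₂ hρ₀ hε hε2
  have h3 : (ν₂ * ρ ^ h) ^ (-d) = ν₂ ^ (-d) * (ρ ^ (-d)) ^ h := by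
    rw [Real.mul_rpow hν₂.le (by positivity), ← Real.rpow_natCast, ← Real.rpow_natCast,
      ← Real.rpow_mul hρ₀.le, ← Real.rpow_mul hρ₀.le, mul_comm (h : ℝ)]
  have h4 : ((1 / ρ) ^ (d + 1)) ^ h = (ρ ^ (-d)) ^ h * (1 / ρ ^ h) := by
    rw [one_div, Real.inv_rpow hρ₀.le, ← Real.rpow_neg hρ₀.le, neg_add,
      Real.rpow_add hρ₀, mul_pow, Real.rpow_neg_one, inv_pow, one_div]
  have hρh : ρ ^ h ≤ 1 / ρ ^ h := by
    have h5 : ρ ^ h ≤ 1 := pow_le_one₀ hρ₀.le hρ₁.le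
    rw [le_div_iff₀ (by positivity)]
    nlinarith [pow_pos hρ₀ h]
  have h5 : N * (4 * L * (ν₁ * ρ ^ h)) +
      2 * N * (32 * L * lam / (ν₁ * ρ ^ (h + 2)) + 8 * L * (ν₁ * ρ ^ h)) =
      N * (4 * L * ν₁ * (5 * ρ ^ h + 16 * lam / (ν₁ ^ 2 * ρ ^ 2) * (1 / ρ ^ h))) := by
    field_simp
    ring
  -- The next step uses `5 ≤ 9 · lam`, valid since `lam ≥ 0.69`, and `ρ^h ≤ ρ^{-h}`; this is where
  -- the constant `9` enters.
  calc _ ≤ N * (4 * L * ν₁ * (5 * ρ ^ h + 16 * lam / (ν₁ ^ 2 * ρ ^ 2) * (1 / ρ ^ h))) := by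
        rw [← h5]; linarith
    _ ≤ (C * (ν₂ * ρ ^ h) ^ (-d)) *
        (4 * L * ν₁ * (9 * lam * (1 / ρ ^ h) + 16 * lam / (ν₁ ^ 2 * ρ ^ 2) * (1 / ρ ^ h))) := by
        gcongr
        linarith
    _ = _ := by rw [h3, h4]; ring

end Levels


/-! ### The starting depth when the packing bound is unavailable there -/

section Initial

variable {X : Type*} [MeasurableSpace X] {M : X → Measure ℝ} {P : Node → Set X}
  {l : X → X → ℝ} {ν₁ ρ ν₂ L ε₀ : ℝ}

/-- The cost of the initial level, in the case of small `ρ`. -/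
theorem initial_level_cost_le_of_le_half (hM : IsEnvironment M) (hP : IsTreeOfCoverings P)
    (hA1 : Shrinking P l ν₁ ρ ν₂) (hA2 : LocallyWeaklyLipschitz (meanPayoff M) l ε₀ L)
    (hL : 0 < L) (hν₁ : 0 < ν₁) (hρ₀ : 0 < ρ) (hρ : ρ ≤ 1 / 2) {z : ℕ}
    (hε : 2 * (ν₁ * ρ ^ z) < ε₀) {lam : ℝ} (hlam : 69 / 100 ≤ lam) :
    (goodNodes (meanPayoff M) P ν₁ ρ z).card * (4 * L * (ν₁ * ρ ^ z)) +
        (badChildren (meanPayoff M) P ν₁ ρ z).card *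
          (16 * lam / (ν₁ * ρ ^ (z + 1)) + 8 * L * (ν₁ * ρ ^ z)) ≤
      ((goodNodes (meanPayoff M) P ν₁ ρ z).card - 1) * (8 * lam / (ν₁ * ρ ^ z) ^ 2) +
      lam * (64 * L / (ν₁ * ρ ^ z * ρ ^ 4) + 36 * L * (ν₁ * ρ ^ z) / ρ ^ (2 * z + 2)) := by
  have hlam0 : 0 < lam := by linarith
  have ha : 0 < ν₁ * ρ ^ z := by positivity
  have hq1 : (1 : ℝ) ≤ (goodNodes (meanPayoff M) P ν₁ ρ z).card := by
    exact_mod_cast hM.one_le_card_goodNodes hν₁ hρ₀ hP hA1 z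
  have hq : ((goodNodes (meanPayoff M) P ν₁ ρ z).card : ℝ) ≤ 2 ^ z := by
    have h1 : goodNodes (meanPayoff M) P ν₁ ρ z ⊆ levelNodes z := fun v hv =>
      mem_levelNodes.2 (mem_goodNodes.1 hv).1
    have h2 := Finset.card_le_card h1
    rw [card_levelNodes] at h2
    exact_mod_cast h2
  have hb : ((badChildren (meanPayoff M) P ν₁ ρ z).card : ℝ) ≤
      2 * (goodNodes (meanPayoff M) P ν₁ ρ z).card := by
    exact_mod_cast card_badChildren_le (meanPayoff M) P ν₁ ρ z
  rw [pow_succ ρ z, ← mul_assoc ν₁]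
  set a := ν₁ * ρ ^ z
  set q : ℝ := ((goodNodes (meanPayoff M) P ν₁ ρ z).card : ℝ)
  rcases (badChildren (meanPayoff M) P ν₁ ρ z).eq_empty_or_nonempty with he | hne
  · rw [he, Finset.card_empty, Nat.cast_zero, zero_mul, add_zero]
    have h1 : q ≤ 1 / ρ ^ (2 * z + 2) := by
      calc q ≤ 2 ^ z := hq
        _ ≤ 2 ^ (2 * z + 2) := pow_le_pow_right₀ (by norm_num) (by omega)
        _ ≤ (1 / ρ) ^ (2 * z + 2) := by
            gcongr
            rw [le_div_iff₀ hρ₀]; linarith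
        _ = _ := by rw [one_div_pow]
    have h2 : q * (4 * L * a) ≤ lam * (36 * L * a / ρ ^ (2 * z + 2)) := by
      calc q * (4 * L * a) ≤ 69 / 100 * (36 * L * a * q) := by
            have : 0 < L * a * q := by positivity
            nlinarith
        _ ≤ lam * (36 * L * a * (1 / ρ ^ (2 * z + 2))) := by gcongr
        _ = _ := by ring
    have h3 : 0 ≤ (q - 1) * (8 * lam / a ^ 2) := mul_nonneg (by linarith) (by positivity)
    have h4 : 0 ≤ lam * (64 * L / (a * ρ ^ 4)) := by positivity
    linarith
  · have hLρ : ρ ≤ L := by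
      rcases hA2.half_le_or_lt_of_nonempty hM hP hA1 hL hν₁ hρ₀ hε hne with h | h <;> linarith
    refine le_trans ?_ (initial_level_cost_le hρ₀ hρ ha hLρ hlam hq1 hq)
    calc _ ≤ q * (4 * L * a) + 2 * q * (16 * lam / (a * ρ) + 8 * L * a) := by gcongr
      _ = _ := by ring

end Initial

/-- The final bound allots `(r/ρ)m` to the deep term, which needs only `m/ρ`; for `ρ ≤ 1/2` at least
`mr` remains for the starting depth. -/
theorem mul_le_div_mul_sub_div {ρ r m : ℝ} (hρ₀ : 0 < ρ) (hρ : ρ ≤ 1 / 2) (hr : 1 / ρ ≤ r)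
    (hm : 0 ≤ m) : m * r ≤ r / ρ * m - m / ρ := by
  have h1 : 2 ≤ 1 / ρ := by rw [le_div_iff₀ hρ₀]; linarith
  have h2 : (r - 1) * 1 ≤ (r - 1) * (1 / ρ - 1) :=
    mul_le_mul_of_nonneg_left (by linarith) (by linarith)
  have h3 : 0 ≤ m * ((r - 1) * (1 / ρ - 1) - 1) := mul_nonneg hm (by linarith)
  have h4 : r / ρ * m - m / ρ - m * r = m * ((r - 1) * (1 / ρ - 1) - 1) := by ring
  linarith

/-- The main term of the bound dominates the cost of the initial level. -/
theorem initial_budget_le {ρ d ν₁ ν₂ L C lam : ℝ} (hρ₀ : 0 < ρ) (hρ₁ : ρ < 1) (hd : 0 ≤ d)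
    (hν₁ : 0 < ν₁) (hν₂ : 0 < ν₂) (hL : 0 < L) (hlam : 0 < lam) {z : ℕ}
    (h : 1 ≤ C * (ν₂ * ρ ^ (z + 1)) ^ (-d)) :
    lam * (64 * L / (ν₁ * ρ ^ z * ρ ^ 4) + 36 * L * (ν₁ * ρ ^ z) / ρ ^ (2 * z + 2)) ≤
      4 * C * L * ν₁ * ν₂ ^ (-d) * (16 / (ν₁ ^ 2 * ρ ^ 2) + 9) * lam *
        ((1 / ρ) ^ (d + 1)) ^ (z + 2) := by
  have h1 : (ν₂ * ρ ^ (z + 1)) ^ (-d) = ν₂ ^ (-d) * (ρ ^ (-d)) ^ (z + 1) := by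
    rw [Real.mul_rpow hν₂.le (by positivity), ← Real.rpow_natCast, ← Real.rpow_natCast,
      ← Real.rpow_mul hρ₀.le, ← Real.rpow_mul hρ₀.le, mul_comm ((z + 1 : ℕ) : ℝ)]
  have h2 : (1 / ρ) ^ (d + 1) = ρ ^ (-d) * (1 / ρ) := by
    rw [one_div, Real.inv_rpow hρ₀.le, ← Real.rpow_neg hρ₀.le, neg_add,
      Real.rpow_add hρ₀, Real.rpow_neg_one]
  have h3 : 1 ≤ ρ ^ (-d) :=
    Real.one_le_rpow_of_pos_of_le_one_of_nonpos hρ₀ hρ₁.le (by linarith)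
  -- The hypothesis comes from the existence of a good node at depth `z + 1`, where (A3) applies. It
  -- bounds `Cν₂^{-d}` from below, so the main constant cannot be too small.
  have h4 : 1 ≤ C * (ν₂ * ρ ^ (z + 1)) ^ (-d) * ρ ^ (-d) := one_le_mul_of_one_le_of_one_le h h3
  have h5 : lam * (64 * L / (ν₁ * ρ ^ z * ρ ^ 4) + 36 * L * (ν₁ * ρ ^ z) / ρ ^ (2 * z + 2)) =
      4 * L * ν₁ * (16 / (ν₁ ^ 2 * ρ ^ 2) + 9) * lam * (1 / ρ ^ (z + 2)) := by
    have h6 : ρ ^ (2 * z + 2) = ρ ^ z * ρ ^ z * ρ ^ 2 := by ring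
    rw [h6, pow_add ρ z 2]
    field_simp
    ring
  have h7 : 4 * C * L * ν₁ * ν₂ ^ (-d) * (16 / (ν₁ ^ 2 * ρ ^ 2) + 9) * lam *
        ((1 / ρ) ^ (d + 1)) ^ (z + 2) =
      4 * L * ν₁ * (16 / (ν₁ ^ 2 * ρ ^ 2) + 9) * lam * (1 / ρ ^ (z + 2)) *
        (C * (ν₂ * ρ ^ (z + 1)) ^ (-d) * ρ ^ (-d)) := by
    rw [h1, h2, mul_pow, one_div_pow, pow_succ (ρ ^ (-d)) (z + 1)]
    ring
  rw [h5, h7]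
  exact le_mul_of_one_le_right (by positivity) h4

end HOO

/-! ### Choice of the cut-off depth and conclusion -/

set_option maxHeartbeats 1000000 in
theorem theorem3 {X Ω : Type*} [MeasurableSpace X] [MeasurableSpace Ω]
    (μ : Measure Ω) [IsProbabilityMeasure μ]
    -- the environment
    (M : X → Measure ℝ) (hM : HOO.IsEnvironment M)
    -- the parameters of the algorithm
    (ν₁ ρ : ℝ) (hν₁ : 0 < ν₁) (hρ₀ : 0 < ρ) (hρ₁ : ρ < 1)
    (P : HOO.Node → Set X) (hP : HOO.IsTreeOfCoverings P)
    -- the assumptions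
    (l : X → X → ℝ) (hl : HOO.IsDissimilarity l)
    (ν₂ L ε₀ C d : ℝ) (hν₂ : 0 < ν₂) (hL : 0 < L) (hε₀ : 0 < ε₀) (hC : 0 < C) (hd : 0 ≤ d)
    (hA1 : HOO.Shrinking P l ν₁ ρ ν₂)
    (hA2 : HOO.LocallyWeaklyLipschitz (HOO.meanPayoff M) l ε₀ L)
    (hA3 : HOO.PackingBound (HOO.meanPayoff M) l ε₀ (4 * L * ν₁ / ν₂) C d)
    -- the starting depth
    (h₀ z : ℕ) (hh₀ : IsLeast {h : ℕ | 2 * ν₁ * ρ ^ h < ε₀} h₀) (hz : h₀ ≤ z)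
    -- the run of the algorithm
    (node : ℕ → Ω → HOO.Node) (arm : ℕ → Ω → X) (reward : ℕ → Ω → ℝ)
    (hrun : HOO.IsRun z ν₁ ρ P M μ node arm reward)
    -- the constant and the number of rounds
    (γ : ℝ)
    (hγ : γ = 4 * C * L * ν₁ * ν₂ ^ (-d) / ((1 / ρ) ^ (d + 1) - 1) *
      (16 / (ν₁ ^ 2 * ρ ^ 2) + 9))
    (n : ℕ) (hn : 2 ≤ n)
    (hnz : (z : ℝ) ≤ 1 / (d + 2) *
      ((Real.log (4 * L * ν₁ * n) - Real.log (γ * Real.log n)) / Real.log (1 / ρ))) :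
    ∫ ω, HOO.regret (HOO.meanPayoff M) arm n ω ∂μ ≤
      (1 + 1 / ρ ^ (d + 2)) * (4 * L * ν₁ * n) ^ ((d + 1) / (d + 2)) *
          (γ * Real.log n) ^ (1 / (d + 2)) +
        (2 ^ z - 1) * (8 * Real.log n / (ν₁ ^ 2 * ρ ^ (2 * z)) + 4) := by
  have hn0 : (0 : ℝ) < n := by exact_mod_cast (by omega : 0 < n)
  have hlam : 69 / 100 ≤ Real.log n := by
    have h1 : Real.log 2 ≤ Real.log n := Real.log_le_log (by norm_num) (by exact_mod_cast hn)
    linarith [Real.log_two_gt_d9]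
  have hlam0 : 0 < Real.log n := by linarith
  have hinv : 1 < 1 / ρ := by rw [lt_div_iff₀ hρ₀]; linarith
  set r : ℝ := (1 / ρ) ^ (d + 1) with hr
  have hr1 : 1 < r := Real.one_lt_rpow hinv (by linarith)
  have hrρ : 1 / ρ ≤ r := by
    calc 1 / ρ = (1 / ρ) ^ (1 : ℝ) := (Real.rpow_one _).symm
      _ ≤ r := Real.rpow_le_rpow_of_exponent_le hinv.le (by linarith)
  have hrd : 1 / ρ ^ (d + 2) = r / ρ := by
    rw [hr, Real.div_rpow zero_le_one hρ₀.le, Real.one_rpow,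
      show d + 2 = (d + 1) + 1 by ring, Real.rpow_add hρ₀ (d + 1) 1, Real.rpow_one, div_div]
  have hr1' : 0 < r - 1 := by linarith
  set K : ℝ := 4 * C * L * ν₁ * ν₂ ^ (-d) * (16 / (ν₁ ^ 2 * ρ ^ 2) + 9) * Real.log n with hK
  have hK0 : 0 < K := by positivity
  have hG : γ * Real.log n = K / (r - 1) := by rw [hγ, hK]; ring
  have hG0 : 0 < γ * Real.log n := by rw [hG]; positivity
  have hA0 : 0 < 4 * L * ν₁ * n := by positivity
  set A : ℝ := 4 * L * ν₁ * n with hA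
  set G : ℝ := γ * Real.log n with hGdef
  -- The real depth at which the deep term `Aρ^s` and the bound `Gr^s` on the cost of the upper
  -- depths both equal `m`.
  set H₀ : ℝ := 1 / (d + 2) * ((Real.log A - Real.log G) / Real.log (1 / ρ)) with hH₀
  have hbal := HOO.balance hA0 hG0 hρ₀ hρ₁ hd
  rw [mul_assoc (1 + 1 / ρ ^ (d + 2))]
  set m : ℝ := A ^ ((d + 1) / (d + 2)) * G ^ (1 / (d + 2)) with hm
  have hm0 : 0 < m := by positivity
  have hdeep : ∀ k j : ℕ, H₀ ≤ k + j → A * ρ ^ k ≤ m / ρ ^ j := by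
    intro k j hkj
    have h1 := (hbal k).1
    rw [Real.rpow_natCast] at h1
    have h2 : m / ρ ^ j = m * ρ ^ (-(j : ℝ)) := by
      rw [Real.rpow_neg hρ₀.le, Real.rpow_natCast, div_eq_mul_inv]
    rw [h1, h2]
    refine mul_le_mul_of_nonneg_left ?_ hm0.le
    exact Real.rpow_le_rpow_of_exponent_ge hρ₀ hρ₁.le (by linarith)
  have hupper : ∀ k : ℕ, (k : ℝ) ≤ H₀ → G * r ^ k ≤ m := by
    intro k hk
    have h1 := (hbal k).2
    rw [Real.rpow_natCast] at h1
    rw [h1]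
    refine mul_le_of_le_one_right hm0.le (Real.rpow_le_one hρ₀.le hρ₁.le ?_)
    exact mul_nonneg (by linarith) (by linarith)
  have hε : 2 * (ν₁ * ρ ^ z) < ε₀ := by
    have h1 : 2 * ν₁ * ρ ^ h₀ < ε₀ := hh₀.1
    have h2 : ρ ^ z ≤ ρ ^ h₀ := pow_le_pow_of_le_one hρ₀.le hρ₁.le hz
    have h3 : 2 * ν₁ * ρ ^ z ≤ 2 * ν₁ * ρ ^ h₀ := by gcongr
    linarith
  have ha0 : 0 < ν₁ * ρ ^ z := by positivity
  have hεh : ∀ h, z ≤ h → ν₁ * ρ ^ h ≤ ν₁ * ρ ^ z := fun h hh => by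
    have : ρ ^ h ≤ ρ ^ z := pow_le_pow_of_le_one hρ₀.le hρ₁.le hh
    gcongr
  -- Beyond depth `z` this gives `ν₂ρ^h ≤ ν₁ρ^{h-1} ≤ ε₀`; only depth `z` can fall outside the range
  -- of (A3).
  have hν : ν₂ * ρ ≤ ν₁ := hA1.ball_radius_le hl hν₁ hρ₀ hν₂ hP.root
  have hε2 : ∀ h, z + 1 ≤ h → ν₂ * ρ ^ h ≤ ε₀ := by
    intro h hh
    obtain ⟨k, rfl⟩ := Nat.exists_eq_add_of_le' hh
    have h1 : ν₂ * ρ ^ (k + (z + 1)) ≤ ν₁ * ρ ^ (k + z) := by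
      calc ν₂ * ρ ^ (k + (z + 1)) = ν₂ * ρ * ρ ^ (k + z) := by ring
        _ ≤ _ := by gcongr
    have h2 := hεh (k + z) (by omega)
    linarith
  set c : ℕ → ℝ := fun h =>
    (HOO.goodNodes (HOO.meanPayoff M) P ν₁ ρ h).card * (4 * L * (ν₁ * ρ ^ h)) +
        (HOO.badChildren (HOO.meanPayoff M) P ν₁ ρ h).card *
          (16 * Real.log n / (ν₁ * ρ ^ (h + 1)) + 8 * L * (ν₁ * ρ ^ h)) with hc
  have hlevel : ∀ h, z ≤ h → ν₂ * ρ ^ h ≤ ε₀ → c h ≤ K * r ^ h := fun h hh h2 =>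
    HOO.level_cost_le hM hl hP hA1 hA2 hA3 hC hL hν₁ hν₂ hρ₀ hρ₁
      (by linarith [hεh h hh]) h2 hlam
  have hsum : ∀ k H : ℕ, z ≤ k → (H : ℝ) ≤ H₀ → (∀ h, k ≤ h → ν₂ * ρ ^ h ≤ ε₀) →
      ∑ h ∈ Finset.Ico k H, c h ≤ m := by
    intro k H hk hH h2
    calc ∑ h ∈ Finset.Ico k H, c h ≤ ∑ h ∈ Finset.Ico k H, K * r ^ h := by
          refine Finset.sum_le_sum fun h hh => ?_
          have h3 := (Finset.mem_Ico.1 hh).1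
          exact hlevel h (by omega) (h2 h h3)
      _ ≤ K * (r ^ H / (r - 1)) := by
          rw [← Finset.mul_sum]
          exact mul_le_mul_of_nonneg_left (HOO.sum_Ico_pow_le hr1 _ _) hK0.le
      _ = G * r ^ H := by rw [hG]; ring
      _ ≤ m := hupper H hH
  set Y : ℝ := 8 * Real.log n / (ν₁ ^ 2 * ρ ^ (2 * z)) + 4 with hY
  have hY' : Y = 8 * Real.log n / (ν₁ * ρ ^ z) ^ 2 + 4 := by rw [hY]; ring_nf
  have hY0 : 0 ≤ Y := by positivity
  -- One good node suffices to turn `2^z - q` into `2^z - 1`; the other `q - 1` leave `(q - 1)Y` to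
  -- spare.
  have hq1 : (1 : ℝ) ≤ (HOO.goodNodes (HOO.meanPayoff M) P ν₁ ρ z).card := by
    exact_mod_cast hM.one_le_card_goodNodes hν₁ hρ₀ hP hA1 z
  have hmain : ∀ H : ℕ, z ≤ H → ∫ ω, HOO.regret (HOO.meanPayoff M) arm n ω ∂μ ≤ A * ρ ^ H +
      (2 ^ z - (HOO.goodNodes (HOO.meanPayoff M) P ν₁ ρ z).card) * Y +
        ∑ h ∈ Finset.Ico z H, c h := by
    intro H hH
    refine (hrun.integral_regret_le hM hν₁ hρ₀ hρ₁ hL hP hA1 hA2 hε hH hn).trans (le_of_eq ?_)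
    rw [hA]
    congr 2
    ring
  set q : ℝ := ((HOO.goodNodes (HOO.meanPayoff M) P ν₁ ρ z).card : ℝ) with hq
  have hH₀0 : 0 ≤ H₀ := (Nat.cast_nonneg z).trans hnz
  have hfl := Nat.floor_le hH₀0
  have hfl' := Nat.lt_floor_add_one H₀
  have hzH : z ≤ ⌊H₀⌋₊ := Nat.le_floor hnz
  have hqY : 0 ≤ (q - 1) * Y := mul_nonneg (by linarith) hY0
  rw [hrd]
  -- If `H₀ < z + 2`, the cut-off `z` works: there are no intermediate depths, and the deep term is
  -- at most `m/ρ² ≤ (r/ρ)m`. Otherwise the cut-off is `⌊H₀⌋`.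
  rcases Nat.lt_or_ge ⌊H₀⌋₊ (z + 2) with hcase | hcase
  · have h1 := hmain z le_rfl
    have h2 := hdeep z 2 (by
      have h3 : (⌊H₀⌋₊ : ℝ) ≤ (z : ℝ) + 1 := by exact_mod_cast (by omega : ⌊H₀⌋₊ ≤ z + 1)
      push_cast; linarith)
    rw [Finset.Ico_self, Finset.sum_empty] at h1
    have h3 : m / ρ ^ 2 ≤ r / ρ * m := by
      calc m / ρ ^ 2 = 1 / ρ / ρ * m := by field_simp
        _ ≤ _ := by gcongr
    linarith
  have h1 := hmain ⌊H₀⌋₊ hzH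
  have h2 := hdeep ⌊H₀⌋₊ 1 (by push_cast; linarith)
  rw [pow_one] at h2
  -- If (A3) applies at depth `z`, every depth is bounded by it. If not, `2ν₁ < ν₂`, and `ν₂ρ ≤ ν₁`
  -- gives `ρ ≤ 1/2`; depth `z` is then paid for by both spare amounts.
  rcases le_or_gt (ν₂ * ρ ^ z) ε₀ with hdeg | hdeg
  · have h3 := hsum z ⌊H₀⌋₊ le_rfl hfl fun h hh => by
      rcases Nat.eq_or_lt_of_le hh with rfl | hlt
      · exact hdeg
      · exact hε2 h hlt
    have h4 : m / ρ ≤ r / ρ * m := by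
      calc m / ρ = 1 / ρ * m := by ring
        _ ≤ _ := by gcongr
    linarith
  · have h3 := hsum (z + 1) ⌊H₀⌋₊ (by omega) hfl hε2
    rw [Finset.sum_eq_sum_Ico_succ_bot (by omega)] at h1
    have hρ : ρ ≤ 1 / 2 := by
      have h4 : 2 * ν₁ * ρ ^ z < ν₂ * ρ ^ z := by linarith
      have h5 : 2 * ν₁ < ν₂ := lt_of_mul_lt_mul_right h4 (by positivity)
      nlinarith
    have h4 : c z ≤ (q - 1) * (8 * Real.log n / (ν₁ * ρ ^ z) ^ 2) + Real.log n *
        (64 * L / (ν₁ * ρ ^ z * ρ ^ 4) + 36 * L * (ν₁ * ρ ^ z) / ρ ^ (2 * z + 2)) :=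
      HOO.initial_level_cost_le_of_le_half hM hP hA1 hA2 hL hν₁ hρ₀ hρ hε hlam
    have h5 : m * r ≤ r / ρ * m - m / ρ := HOO.mul_le_div_mul_sub_div hρ₀ hρ hrρ hm0.le
    have h6 : Real.log n *
        (64 * L / (ν₁ * ρ ^ z * ρ ^ 4) + 36 * L * (ν₁ * ρ ^ z) / ρ ^ (2 * z + 2)) ≤ m * r := by
      have h7 := hupper (z + 2) ((by exact_mod_cast hcase : ((z + 2 : ℕ) : ℝ) ≤ ⌊H₀⌋₊).trans hfl)
      have h8 : K * r ^ (z + 1) ≤ m := by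
        have h9 : K = G * (r - 1) := by rw [hG, div_mul_cancel₀ _ hr1'.ne']
        have h10 : 0 ≤ G * r ^ (z + 1) := by positivity
        have h11 : K * r ^ (z + 1) = G * r ^ (z + 2) - G * r ^ (z + 1) := by rw [h9]; ring
        linarith
      have h9 : (1 : ℝ) ≤ C * (ν₂ * ρ ^ (z + 1)) ^ (-d) := by
        refine le_trans ?_ (hA3.card_goodNodes_le hM hl hA1 hA2 hC hL hν₁ hν₂ hρ₀ (h := z + 1)
          (by linarith [hεh (z + 1) (by omega)]) (hε2 _ le_rfl))
        exact_mod_cast hM.one_le_card_goodNodes hν₁ hρ₀ hP hA1 (z + 1)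
      calc _ ≤ K * r ^ (z + 2) := HOO.initial_budget_le hρ₀ hρ₁ hd hν₁ hν₂ hL hlam0 h9
        _ = K * r ^ (z + 1) * r := by
            rw [pow_succ r (z + 1)]; exact (mul_assoc _ _ _).symm
        _ ≤ m * r := by gcongr
    have h7 : (q - 1) * (8 * Real.log n / (ν₁ * ρ ^ z) ^ 2) ≤ (q - 1) * Y := by
      rw [hY']
      have : 0 ≤ q - 1 := by linarith
      gcongr
      linarith
    linarith
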